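/- Let $p$ be a prime, $r\ge 1$, $q=p^r$, and let $l$ be a prime with $l\ne 2$ and $l\neq p$. Let $k$ be a field with $\operatorname{char} k\ne l$, and let $d$ be the smallest positive integer such that $l\mid q^d-1$. Let $n\ge 0$, write $\overline{a}=a^q$ for the nontrivial automorphism of $\mathbb F_{q^2}$ over $\mathbb F_q$, let $\beta\in GL_n(\mathbb F_{q^2})$ be an invertible Hermitian matrix (that is, $\beta^T=\overline\beta$), and let $U(n,q^2)=\{M\in GL_n(\mathbb F_{q^2}) : M^T\beta\overline M=\beta\}$ be the corresponding unitary group. For a finite group $G$, a field extension $F/k$ and a $G$-torsor $t$ over $\operatorname{Spec}F$, let $\operatorname{ed}_k(t,l)$ be the minimum of $\operatorname{trdeg}_k(M)$ over all finite field extensions $E/F$ with $l\nmid [E:F]$ and all intermediate fields $k\subseteq M\subseteq E$ such that the base change $t_E$ is isomorphic to the base change to $E$ of some $G$-torsor over $\operatorname{Spec} M$; and let $\operatorname{ed}_k(G,l)$, the essential $l$-dimension of $G$ over $k$, be the supremum of $\operatorname{ed}_k(t,l)$ over all field extensions $F/k$ and all $G$-torsors $t$ over $\operatorname{Spec} F$.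 Then $$\operatorname{ed}_k(U(n,q^2),l)=\begin{cases}\operatorname{ed}_k(GL_n(\mathbb F_{q^2}),l), & d\equiv 2 \pmod 4,\\ \operatorname{ed}_k(GL_{\lfloor n/2\rfloor}(\mathbb F_{q^2}),l), & d\not\equiv 2\pmod 4.\end{cases}$$ -/

import Mathlib

open scoped TensorProduct Matrix

universe u v

noncomputable section

/-! ### Torsors of a finite group over a field, as Galois algebras -/

/-- For an action `ρ` of `G` on a commutative `F`-algebra `L` by `F`-algebra automorphisms, the map
`L ⊗[F] L → ∏_{g ∈ G} L`, `a ⊗ b ↦ (a * g b)_g`. It is dual to the map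
`Spec L × G → Spec L ×_F Spec L`, `(x, g) ↦ (x, x g)`. -/
def galoisMap {G : Type v} {F L : Type u} [Group G] [Field F] [CommRing L] [Algebra F L]
    (ρ : G →* (L ≃ₐ[F] L)) : L ⊗[F] L →ₐ[F] (G → L) :=
  AlgHom.pi fun g =>
    Algebra.TensorProduct.productMap (AlgHom.id F L) (ρ g : L →ₐ[F] L)

/-- A `G`-torsor over `Spec F` for a finite group `G` (a Galois `G`-algebra over `F`): a nonzero
commutative `F`-algebra `L` with an action of `G` by `F`-algebra automorphisms such that
`L ⊗[F] L → ∏_{g ∈ G} L` is bijective. -/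
structure GaloisAlgebra (G : Type v) [Group G] (F : Type u) [Field F] where
  carrier : Type u
  [commRing : CommRing carrier]
  [algebra : Algebra F carrier]
  nontrivial : Nontrivial carrier
  action : G →* (carrier ≃ₐ[F] carrier)
  bijective : Function.Bijective (galoisMap action)

attribute [instance] GaloisAlgebra.commRing GaloisAlgebra.algebra

namespace GaloisAlgebra

variable {G : Type v} [Group G]

/-- The action of `g ∈ G` on the base change `E ⊗[F] L` of a `G`-torsor along `F → E`. -/
def baseAction {F : Type u} [Field F] (t : GaloisAlgebra G F) (E : Type u) [Field E] [Algebra F E]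
    (g : G) : E ⊗[F] t.carrier →ₐ[E] E ⊗[F] t.carrier :=
  Algebra.TensorProduct.map (AlgHom.id E E) (t.action g : t.carrier →ₐ[F] t.carrier)

/-- For field extensions `F → E` and `M → E`, the torsors `t` over `F` and `s` over `M` become
isomorphic (`G`-equivariantly, as `E`-algebras) over `E`, that is, they have the same image
in `H¹(E, G)`. -/
def SameOver {F M : Type u} [Field F] [Field M] (t : GaloisAlgebra G F) (s : GaloisAlgebra G M)
    (E : Type u) [Field E] [Algebra F E] [Algebra M E] : Prop :=
  ∃ e : (E ⊗[M] s.carrier) ≃ₐ[E] (E ⊗[F] t.carrier),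
    ∀ (g : G) (x : E ⊗[M] s.carrier), e (s.baseAction E g x) = t.baseAction E g (e x)

/-- The essential `l`-dimension `ed_k(t, l)` of a `G`-torsor `t` over `F ⊇ k`: the minimum of
`trdeg_k M` over all finite extensions `E / F` of degree prime to `l` and all intermediate fields
`k ⊆ M ⊆ E` such that the image of `t` in `H¹(E, G)` comes from `H¹(M, G)`. -/
def essDim (k : Type u) [Field k] (l : ℕ) {F : Type u} [Field F] [Algebra k F]
    (t : GaloisAlgebra G F) : ℕ∞ :=
  ⨅ (E : Type u) (_ : Field E) (_ : Algebra k E) (_ : Algebra F E) (_ : IsScalarTower k F E)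
    (_ : FiniteDimensional F E) (_ : ¬ l ∣ Module.finrank F E)
    (M : IntermediateField k E) (_ : ∃ s : GaloisAlgebra G M, t.SameOver s E),
    Cardinal.toENat (Algebra.trdeg k M)

end GaloisAlgebra

/-- The essential `l`-dimension `ed_k(G, l)` of a finite group `G`: the supremum of `ed_k(t, l)`
over all field extensions `F / k` and all `G`-torsors `t` over `Spec F`. -/
def essDim (k : Type u) [Field k] (G : Type v) [Group G] (l : ℕ) : ℕ∞ :=
  ⨆ (F : Type u) (_ : Field F) (_ : Algebra k F) (t : GaloisAlgebra G F), t.essDim k l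

/-! ### Unitary groups over finite fields -/

/-- The unitary group `{M ∈ GL_n(K) : Mᵀ β σ(M) = β}` of a matrix `β` with respect to a ring
endomorphism `σ` of `K`, applied entrywise. -/
def hermitianUnitaryGroup {K : Type v} [Field K] {n : ℕ} (σ : K →+* K) (β : Matrix (Fin n) (Fin n) K) :
    Subgroup (GL (Fin n) K) where
  carrier := {M | M.valᵀ * β * M.val.map σ = β}
  one_mem' := by simp
  mul_mem' := by
    intro A B hA hB
    simp only [Set.mem_setOf_eq, Units.val_mul, Matrix.transpose_mul, Matrix.map_mul] at *
    calc B.valᵀ * A.valᵀ * β * (A.val.map σ * B.val.map σ)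
        = B.valᵀ * (A.valᵀ * β * A.val.map σ) * B.val.map σ := by simp only [Matrix.mul_assoc]
      _ = β := by rw [hA, hB]
  inv_mem' := by
    intro A hA
    simp only [Set.mem_setOf_eq] at *
    have h1 : (A⁻¹).valᵀ * A.valᵀ = 1 := by
      rw [← Matrix.transpose_mul, ← Units.val_mul, mul_inv_cancel]; simp
    have h2 : A.val.map σ * (A⁻¹).val.map σ = 1 := by
      rw [← Matrix.map_mul, ← Units.val_mul, mul_inv_cancel]; simp
    calc (A⁻¹).valᵀ * β * (A⁻¹).val.map σ
        = (A⁻¹).valᵀ * (A.valᵀ * β * A.val.map σ) * (A⁻¹).val.map σ := by rw [hA]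
      _ = ((A⁻¹).valᵀ * A.valᵀ) * β * (A.val.map σ * (A⁻¹).val.map σ) := by
          simp only [Matrix.mul_assoc]
      _ = β := by rw [h1, h2, one_mul, mul_one]

/-- The nontrivial automorphism `a ↦ a ^ q` of `𝔽_{q²}` over `𝔽_q`, where `q = p ^ r`. -/
def conjFq (p r : ℕ) [Fact p.Prime] : GaloisField p (2 * r) →+* GaloisField p (2 * r) :=
  iterateFrobenius (GaloisField p (2 * r)) p r

/-- `U(n, q²)` for `q = p ^ r`, with respect to the Hermitian matrix `β`. -/
abbrev UnitaryFq (p r n : ℕ) [Fact p.Prime]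
    (β : Matrix (Fin n) (Fin n) (GaloisField p (2 * r))) :
    Subgroup (GL (Fin n) (GaloisField p (2 * r))) :=
  hermitianUnitaryGroup (conjFq p r) β

end

/-!
If `H` is a subgroup of index prime to `l` in `G`, then `ed(H, l) = ed(G, l)`: inducing torsors
from `H` to `G` gives `≤`, since an `H`-torsor can be recovered from the induced `G`-torsor after
a finite extension of the field of definition, and conversely a `G`-torsor `t` over `F` is induced
from an `H`-torsor after an extension of `F` of degree prime to `l`, namely a residue field of the
finite scheme `t / H`, which has degree `[G : H]` over `F`.

Write `x` for the class of `q` modulo `l`, which has order `d`. Counting orthonormal families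
gives `|U(n, q²)| = ∏_{i ≤ n} q^{i-1} (q^i - (-1)^i)`. If `d ≡ 2 (mod 4)`, then `x^i ≠ -(-1)^i`
for all `i`, so `U(n, q²)` has index prime to `l` in `GL_n(𝔽_{q²})`. Otherwise `x^i ≠ -1` for all
odd `i`, so `GL_{⌊n/2⌋}(𝔽_{q²})`, embedded in `U(n, q²)` as the Levi subgroup of the stabilizer of
a totally isotropic subspace, has index prime to `l`.
-/

section GaloisAction

variable {G H K R S T L B C : Type*} [Group G] [Group H] [Group K] [CommRing R] [CommRing S]
  [CommRing T] [CommRing L] [Algebra R L] [CommRing B] [Algebra S B] [CommRing C] [Algebra T C]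

/-! ### Galois actions over a commutative ring -/

/-- A ring homomorphism `f : L →+* B` from an algebra with an action of `G` to one with an action
of `H` that is equivariant along `φ : H →* G` and lies over `j` on the base rings. On spectra these
are the equivariant maps between torsors for varying groups over varying bases. -/
structure IsEquivariantHom (φ : H →* G) (j : R →+* S) (ρ : G →* (L ≃ₐ[R] L))
    (σ : H →* (B ≃ₐ[S] B)) (f : L →+* B) : Prop where
  map_action : ∀ h x, f (ρ (φ h) x) = σ h (f x)
  map_algebraMap : ∀ a, f (algebraMap R L a) = algebraMap S B (j a)

/-- Galois coordinates for an action `ρ`: finite families with `∑ i, x i * ρ g (y i) = δ_{g, 1}`,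
that is, a preimage of the indicator of `1` under `a ⊗ b ↦ (a * ρ g b)_g`. -/
structure IsGaloisCoords {ι : Type*} [Fintype ι] (ρ : G →* (L ≃ₐ[R] L)) (x y : ι → L) :
    Prop where
  sum_mul : ∑ i, x i * y i = 1
  sum_mul_apply : ∀ g, g ≠ 1 → ∑ i, x i * ρ g (y i) = 0

/-- An action of a finite group on a commutative `R`-algebra is Galois if the invariants come
from `R`, some element has trace one, and there are Galois coordinates. Over a field this amounts
to the bijectivity of `galoisMap`, but this form makes sense over any base ring and is visibly
stable under base change, restriction and induction. -/
structure IsGaloisAction [Fintype G] (ρ : G →* (L ≃ₐ[R] L)) : Prop where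
  exists_algebraMap_eq : ∀ x : L, (∀ g, ρ g x = x) → ∃ a, algebraMap R L a = x
  exists_trace_eq_one : ∃ c : L, ∑ g, ρ g c = 1
  exists_coords : ∃ (m : ℕ) (x y : Fin m → L), IsGaloisCoords ρ x y

theorem IsEquivariantHom.comp {φ : H →* G} {j : R →+* S} {ρ : G →* (L ≃ₐ[R] L)}
    {σ : H →* (B ≃ₐ[S] B)} {f : L →+* B} {ψ : K →* H} {j' : S →+* T} {τ : K →* (C ≃ₐ[T] C)}
    {f' : B →+* C} (hf' : IsEquivariantHom ψ j' σ τ f') (hf : IsEquivariantHom φ j ρ σ f) :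
    IsEquivariantHom (φ.comp ψ) (j'.comp j) ρ τ (f'.comp f) where
  map_action h x := by simp [hf.map_action, hf'.map_action]
  map_algebraMap a := by simp [hf.map_algebraMap, hf'.map_algebraMap]

theorem apply_sum_action [Fintype G] (ρ : G →* (L ≃ₐ[R] L)) (g : G) (x : L) :
    ρ g (∑ h, ρ h x) = ∑ h, ρ h x := by
  rw [map_sum]
  exact Fintype.sum_equiv (Equiv.mulLeft g) _ _ fun h => by simp

namespace IsGaloisCoords

variable {ι : Type*} [Fintype ι] {ρ : G →* (L ≃ₐ[R] L)} {x y : ι → L}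

theorem sum_mul_apply_eq_ite [DecidableEq G] (h : IsGaloisCoords ρ x y) (g : G) :
    ∑ i, x i * ρ g (y i) = if g = 1 then 1 else 0 := by
  split_ifs with hg
  · simpa [hg] using h.sum_mul
  · exact h.sum_mul_apply g hg

theorem exists_fin (h : IsGaloisCoords ρ x y) :
    ∃ (m : ℕ) (x y : Fin m → L), IsGaloisCoords ρ x y := by
  let e := (Fintype.equivFin ι).symm
  exact ⟨_, x ∘ e, y ∘ e, (e.sum_comp fun i => x i * y i).trans h.sum_mul,
    fun g hg => (e.sum_comp fun i => x i * ρ g (y i)).trans (h.sum_mul_apply g hg)⟩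

theorem map {φ : H →* G} {j : R →+* S} {σ : H →* (B ≃ₐ[S] B)} {f : L →+* B}
    (h : IsGaloisCoords ρ x y) (hφ : Function.Injective φ) (hf : IsEquivariantHom φ j ρ σ f) :
    IsGaloisCoords σ (f ∘ x) (f ∘ y) where
  sum_mul := by simpa using congrArg f h.sum_mul
  sum_mul_apply g hg := by
    simpa [hf.map_action] using
      congrArg f (h.sum_mul_apply (φ g) ((map_ne_one_iff φ hφ).2 hg))

theorem sum_mul_trace [Fintype G] (h : IsGaloisCoords ρ x y) (z : L) :
    ∑ i, x i * ∑ g, ρ g (y i * z) = z := by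
  classical
  simp only [Finset.mul_sum, map_mul, ← mul_assoc]
  rw [Finset.sum_comm]
  simp only [← Finset.sum_mul, h.sum_mul_apply_eq_ite, ite_mul, one_mul, zero_mul,
    Finset.sum_ite_eq', Finset.mem_univ, if_true, map_one, AlgEquiv.one_apply]

end IsGaloisCoords

namespace IsGaloisAction

variable [Fintype G] {ρ : G →* (L ≃ₐ[R] L)}

theorem exists_algebraMap_eq_trace (hρ : IsGaloisAction ρ) (x : L) :
    ∃ a, algebraMap R L a = ∑ g, ρ g x :=
  hρ.exists_algebraMap_eq _ fun g => apply_sum_action ρ g x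

theorem finite (hρ : IsGaloisAction ρ) : Module.Finite R L := by
  classical
  obtain ⟨m, x, y, hxy⟩ := hρ.exists_coords
  refine ⟨⟨Finset.univ.image x, eq_top_iff.2 fun z _ => ?_⟩⟩
  rw [← hxy.sum_mul_trace z]
  refine Submodule.sum_mem _ fun i _ => ?_
  obtain ⟨a, ha⟩ := hρ.exists_algebraMap_eq_trace (y i * z)
  rw [← ha, mul_comm, ← Algebra.smul_def]
  exact Submodule.smul_mem _ _ (Submodule.subset_span (by simp))

theorem bijective_of_isEquivariantHom [Algebra R B] {σ : G →* (B ≃ₐ[R] B)} {f : L →+* B}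
    (hρ : IsGaloisAction ρ) (hσ : IsGaloisAction σ) (hinj : Function.Injective (algebraMap R B))
    (hf : IsEquivariantHom (MonoidHom.id G) (RingHom.id R) ρ σ f) : Function.Bijective f := by
  obtain ⟨m, x, y, hxy⟩ := hρ.exists_coords
  constructor
  · rw [injective_iff_map_eq_zero]
    intro z hz
    rw [← hxy.sum_mul_trace z]
    refine Finset.sum_eq_zero fun i _ => ?_
    obtain ⟨a, ha⟩ := hρ.exists_algebraMap_eq_trace (y i * z)
    have hfa : algebraMap R B a = 0 := by
      rw [← RingHom.id_apply a, ← hf.map_algebraMap, ha, map_sum]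
      exact Finset.sum_eq_zero fun g _ => (hf.map_action g _).trans (by simp [hz])
    rw [← ha, (map_eq_zero_iff _ hinj).1 hfa, map_zero, mul_zero]
  · intro z
    choose a ha using fun i => hσ.exists_algebraMap_eq_trace (f (y i) * z)
    refine ⟨∑ i, x i * algebraMap R L (a i), ?_⟩
    rw [← (hxy.map Function.injective_id hf).sum_mul_trace z]
    simp [hf.map_algebraMap, ha]

end IsGaloisAction

/-! ### Base change -/

section BaseChange

variable (ρ : G →* (L ≃ₐ[R] L)) (R' : Type*) [CommRing R'] [Algebra R R']

/-- The action of `G` on the second factor of a base change `R' ⊗[R] L`. -/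
noncomputable def baseChangeAction : G →* (R' ⊗[R] L ≃ₐ[R'] R' ⊗[R] L) where
  toFun g := Algebra.TensorProduct.congr AlgEquiv.refl (ρ g)
  map_one' := by
    rw [map_one]
    exact Algebra.TensorProduct.congr_refl
  map_mul' g h := by
    rw [map_mul]
    exact Algebra.TensorProduct.congr_trans AlgEquiv.refl AlgEquiv.refl (ρ h) (ρ g)

@[simp]
theorem baseChangeAction_tmul (g : G) (a : R') (b : L) :
    baseChangeAction ρ R' g (a ⊗ₜ b) = a ⊗ₜ ρ g b := by
  simp [baseChangeAction]

theorem isEquivariantHom_includeRight :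
    IsEquivariantHom (MonoidHom.id G) (algebraMap R R') ρ (baseChangeAction ρ R')
      (Algebra.TensorProduct.includeRight : L →ₐ[R] R' ⊗[R] L).toRingHom where
  map_action g x := (baseChangeAction_tmul ρ R' g 1 x).symm
  map_algebraMap a := (Algebra.TensorProduct.includeRight : L →ₐ[R] R' ⊗[R] L).commutes a

variable {ρ R'}

theorem IsEquivariantHom.exists_lift {φ : H →* G} {j : R' →+* S} {σ : H →* (B ≃ₐ[S] B)}
    {f : L →+* B} (hf : IsEquivariantHom φ (j.comp (algebraMap R R')) ρ σ f) :
    ∃ f' : R' ⊗[R] L →+* B, IsEquivariantHom φ j (baseChangeAction ρ R') σ f' := by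
  let := (f.comp (algebraMap R L)).toAlgebra
  let fR : L →ₐ[R] B := { f with commutes' := fun _ => rfl }
  let jR : R' →ₐ[R] B :=
    { (algebraMap S B).comp j with commutes' := fun a => (hf.map_algebraMap a).symm }
  have key : ∀ a x, Algebra.TensorProduct.productMap jR fR (a ⊗ₜ x) = algebraMap S B (j a) * f x :=
    fun a x => Algebra.TensorProduct.productMap_apply_tmul jR fR a x
  refine ⟨(Algebra.TensorProduct.productMap jR fR).toRingHom, fun h w => ?_, fun a => ?_⟩
  · change Algebra.TensorProduct.productMap jR fR _ = σ h (Algebra.TensorProduct.productMap jR fR w)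
    induction w using TensorProduct.induction_on with
    | zero => simp
    | tmul a b => rw [baseChangeAction_tmul, key, key, map_mul, hf.map_action, AlgEquiv.commutes]
    | add a b ha hb => simp only [map_add, ha, hb]
  · exact (key a 1).trans (by rw [map_one, mul_one])

theorem IsGaloisAction.exists_algebraMap_eq_trace_baseChange [Fintype G] (hρ : IsGaloisAction ρ)
    (w : R' ⊗[R] L) : ∃ a, algebraMap R' _ a = ∑ g, baseChangeAction ρ R' g w := by
  induction w using TensorProduct.induction_on with
  | zero => exact ⟨0, by simp⟩
  | tmul a b =>
    obtain ⟨s, hs⟩ := hρ.exists_algebraMap_eq_trace b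
    refine ⟨s • a, ?_⟩
    simp only [baseChangeAction_tmul, ← TensorProduct.tmul_sum, ← hs]
    rw [Algebra.algebraMap_eq_smul_one s, ← TensorProduct.smul_tmul]
    rfl
  | add a b ha hb =>
    obtain ⟨s, hs⟩ := ha
    obtain ⟨s', hs'⟩ := hb
    exact ⟨s + s', by simp only [map_add, Finset.sum_add_distrib, hs, hs']⟩

variable (R') in
theorem IsGaloisAction.baseChange [Fintype G] (hρ : IsGaloisAction ρ) :
    IsGaloisAction (baseChangeAction ρ R') := by
  obtain ⟨c, hc⟩ := hρ.exists_trace_eq_one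
  obtain ⟨m, x, y, hxy⟩ := hρ.exists_coords
  have htrace : ∑ g, baseChangeAction ρ R' g (1 ⊗ₜ c) = 1 := by
    simp only [baseChangeAction_tmul, ← TensorProduct.tmul_sum, hc, Algebra.TensorProduct.one_def]
  refine ⟨fun z hz => ?_, ⟨1 ⊗ₜ c, htrace⟩,
    m, _, _, hxy.map Function.injective_id (isEquivariantHom_includeRight ρ R')⟩
  obtain ⟨a, ha⟩ := hρ.exists_algebraMap_eq_trace_baseChange (z * (1 ⊗ₜ c))
  refine ⟨a, ha.trans ?_⟩
  simp only [map_mul, hz, ← Finset.mul_sum, htrace, mul_one]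

variable (R') in
/-- A normalized trace splits off the base ring from a Galois algebra. -/
theorem IsGaloisAction.nontrivial_baseChange [Fintype G] [Nontrivial R'] (hρ : IsGaloisAction ρ)
    (hinj : Function.Injective (algebraMap R L)) : Nontrivial (R' ⊗[R] L) := by
  obtain ⟨c, hc⟩ := hρ.exists_trace_eq_one
  choose τ hτ using fun x => hρ.exists_algebraMap_eq_trace x
  let π : L →ₗ[R] R :=
    { toFun := fun x => τ (c * x)
      map_add' := fun a b => hinj (by simp [hτ, mul_add, Finset.sum_add_distrib])
      map_smul' := fun a b => hinj (by
        simp [hτ, Algebra.smul_def, Finset.mul_sum, mul_left_comm]) }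
  have hπ : π 1 = 1 := hinj (by simp [π, hτ, hc])
  let retr : R' ⊗[R] L →ₗ[R] R' := (TensorProduct.rid R R').toLinearMap ∘ₗ π.lTensor R'
  refine nontrivial_of_ne (1 : R' ⊗[R] L) 0 fun h => ?_
  simpa [retr, Algebra.TensorProduct.one_def, hπ] using congrArg retr h

end BaseChange

/-! ### Restriction to a subgroup -/

section Restriction

/-- The subalgebra of elements invariant under the subgroup `φ.range`. -/
def invariantSubalgebra (ρ : G →* (L ≃ₐ[R] L)) (φ : H →* G) : Subalgebra R L where
  carrier := {x | ∀ h, ρ (φ h) x = x}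
  mul_mem' ha hb h := by rw [map_mul, ha h, hb h]
  add_mem' ha hb h := by rw [map_add, ha h, hb h]
  algebraMap_mem' a h := by simp

/-- The restriction of an action of `G` along `φ : H →* G`, with the base ring enlarged to the
`H`-invariants, over which it is again Galois. -/
def restrictAction (ρ : G →* (L ≃ₐ[R] L)) (φ : H →* G) :
    H →* (L ≃ₐ[invariantSubalgebra ρ φ] L) where
  toFun h := AlgEquiv.ofRingEquiv (f := (ρ (φ h)).toRingEquiv) fun a => a.2 h
  map_one' := by ext x; simp
  map_mul' a b := AlgEquiv.ext fun x => DFunLike.congr_fun (map_mul (ρ.comp φ) a b) x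

@[simp]
theorem restrictAction_apply (ρ : G →* (L ≃ₐ[R] L)) (φ : H →* G) (h : H) (x : L) :
    restrictAction ρ φ h x = ρ (φ h) x := rfl

theorem isEquivariantHom_restrictAction (ρ : G →* (L ≃ₐ[R] L)) (φ : H →* G) :
    IsEquivariantHom φ (algebraMap R (invariantSubalgebra ρ φ)) ρ (restrictAction ρ φ)
      (RingHom.id L) :=
  ⟨fun _ _ => rfl, fun _ => rfl⟩

theorem IsEquivariantHom.exists_invariants [Fintype H] {φ : H →* G} {j : R →+* S}
    {ρ : G →* (L ≃ₐ[R] L)} {σ : H →* (B ≃ₐ[S] B)} {f : L →+* B}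
    (hf : IsEquivariantHom φ j ρ σ f) (hσ : IsGaloisAction σ)
    (hinj : Function.Injective (algebraMap S B)) :
    ∃ ψ : invariantSubalgebra ρ φ →+* S,
      IsEquivariantHom (MonoidHom.id H) ψ (restrictAction ρ φ) σ f ∧
        ψ.comp (algebraMap R _) = j := by
  choose ψ hψ using fun a : invariantSubalgebra ρ φ =>
    hσ.exists_algebraMap_eq (f a) fun h => by rw [← hf.map_action, a.2 h]
  let ψ' : invariantSubalgebra ρ φ →+* S :=
    { toFun := ψ
      map_one' := hinj (by simp [hψ])
      map_mul' := fun a b => hinj (by simp [hψ])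
      map_zero' := hinj (by simp [hψ])
      map_add' := fun a b => hinj (by simp [hψ]) }
  exact ⟨ψ', ⟨hf.map_action, fun a => (hψ a).symm⟩,
    RingHom.ext fun a => hinj ((hψ _).trans (hf.map_algebraMap a))⟩

theorem out_mul_bijective (S : Subgroup G) :
    Function.Bijective fun p : (G ⧸ S) × S => p.1.out * p.2 := by
  constructor
  · rintro ⟨r, h⟩ ⟨r', h'⟩ e
    simp only at e
    have hr : r = r' := by
      simpa using congrArg (QuotientGroup.mk (s := S)) e
    subst hr
    exact Prod.ext rfl (Subtype.ext (mul_left_cancel e))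
  · intro g
    obtain ⟨h, hh⟩ := QuotientGroup.mk_out_eq_mul S g
    exact ⟨(g, h⁻¹), by simp [hh]⟩

theorem sum_quotient_sum {M : Type*} [AddCommMonoid M] [Fintype G] [Fintype H] {φ : H →* G}
    [Fintype (G ⧸ φ.range)] (hφ : Function.Injective φ) (f : G → M) :
    ∑ r : G ⧸ φ.range, ∑ h, f (r.out * φ h) = ∑ g, f g := by
  let e : (G ⧸ φ.range) × H ≃ (G ⧸ φ.range) × φ.range :=
    Equiv.prodCongr (Equiv.refl _) (φ.ofInjective hφ).toEquiv
  rw [← Fintype.sum_prod_type' (f := fun (r : G ⧸ φ.range) h => f (r.out * φ h))]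
  exact Fintype.sum_bijective _ ((out_mul_bijective φ.range).comp e.bijective) _ _ fun _ => rfl

theorem IsGaloisAction.restrict [Fintype G] [Fintype H] {ρ : G →* (L ≃ₐ[R] L)}
    (hρ : IsGaloisAction ρ) {φ : H →* G} (hφ : Function.Injective φ) :
    IsGaloisAction (restrictAction ρ φ) := by
  let := Fintype.ofFinite (G ⧸ φ.range)
  obtain ⟨c, hc⟩ := hρ.exists_trace_eq_one
  obtain ⟨m, x, y, hxy⟩ := hρ.exists_coords
  refine ⟨fun z hz => ⟨⟨z, hz⟩, rfl⟩, ⟨∑ r : G ⧸ φ.range, ρ r.out⁻¹ c, ?_⟩,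
    m, _, _, hxy.map hφ (isEquivariantHom_restrictAction ρ φ)⟩
  calc ∑ h, restrictAction ρ φ h (∑ r : G ⧸ φ.range, ρ r.out⁻¹ c)
      = ∑ h, ∑ r : G ⧸ φ.range, ρ (r.out * φ h⁻¹)⁻¹ c := by simp
    _ = ∑ r : G ⧸ φ.range, ∑ h, ρ (r.out * φ h)⁻¹ c := by
        rw [← Equiv.sum_comp (Equiv.inv H), Finset.sum_comm]
        simp
    _ = ∑ g, ρ g⁻¹ c := sum_quotient_sum hφ fun g => ρ g⁻¹ c
    _ = 1 := (Equiv.sum_comp (Equiv.inv G) fun g => ρ g c).trans hc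

end Restriction
end GaloisAction

section Induction

variable {G H R S L B : Type*} [Group G] [Group H] [CommRing R] [CommRing S] [CommRing L]
  [Algebra R L] [CommRing B] [Algebra S B]

/-! ### Induction from a subgroup -/

/-- The algebra induced from an `H`-algebra `B` along `φ : H →* G`: the `H`-equivariant functions
`G → B`. -/
def inducedSubalgebra (σ : H →* (B ≃ₐ[S] B)) (φ : H →* G) : Subalgebra S (G → B) where
  carrier := {f | ∀ h g, f (φ h * g) = σ h (f g)}
  mul_mem' ha hb h g := by simp [ha h g, hb h g]
  add_mem' ha hb h g := by simp [ha h g, hb h g]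
  algebraMap_mem' a h g := by simp

/-- The action of `G` on the induced algebra by right translation. -/
def inducedAction (σ : H →* (B ≃ₐ[S] B)) (φ : H →* G) :
    G →* (inducedSubalgebra σ φ ≃ₐ[S] inducedSubalgebra σ φ) :=
  (AlgEquiv.algHomUnitsEquiv S (inducedSubalgebra σ φ)).toMonoidHom.comp <| MonoidHom.toHomUnits
    { toFun := fun g =>
        { toFun := fun f => ⟨fun x => f.1 (x * g), fun h x =>
            (congrArg f.1 (mul_assoc _ _ _)).trans (f.2 h _)⟩
          map_one' := rfl
          map_mul' := fun _ _ => rfl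
          map_zero' := rfl
          map_add' := fun _ _ => rfl
          commutes' := fun _ => rfl }
      map_one' := by ext f x; exact congrArg f.1 (mul_one x)
      map_mul' := fun a b => by ext f x; exact congrArg f.1 (mul_assoc x a b).symm }

@[simp]
theorem inducedAction_apply (σ : H →* (B ≃ₐ[S] B)) (φ : H →* G) (g : G)
    (f : inducedSubalgebra σ φ) (x : G) : (inducedAction σ φ g f).1 x = f.1 (x * g) := rfl

/-- Frobenius reciprocity. -/
theorem IsEquivariantHom.exists_induced {φ : H →* G} {j : R →+* S} {ρ : G →* (L ≃ₐ[R] L)}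
    {σ : H →* (B ≃ₐ[S] B)} {f : L →+* B} (hf : IsEquivariantHom φ j ρ σ f) :
    ∃ f' : L →+* inducedSubalgebra σ φ,
      IsEquivariantHom (MonoidHom.id G) j ρ (inducedAction σ φ) f' := by
  let f' : L →+* inducedSubalgebra σ φ :=
    (RingHom.pi fun g => f.comp (ρ g : L →+* L)).codRestrict _ fun x h g =>
      (congrArg f (DFunLike.congr_fun (map_mul ρ (φ h) g) x)).trans (hf.map_action h _)
  refine ⟨f', fun g x => Subtype.ext (funext fun u => ?_),
    fun a => Subtype.ext (funext fun u => ?_)⟩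
  · change f (ρ u (ρ g x)) = f (ρ (u * g) x)
    rw [map_mul, AlgEquiv.mul_apply]
  · change f (ρ u (algebraMap R L a)) = algebraMap S B (j a)
    rw [AlgEquiv.commutes, hf.map_algebraMap]

/-- Evaluation of an induced function at the identity, the counit of Frobenius reciprocity. -/
def inducedEval (σ : H →* (B ≃ₐ[S] B)) (φ : H →* G) : inducedSubalgebra σ φ →+* B :=
  (Pi.evalRingHom (fun _ : G => B) 1).comp (inducedSubalgebra σ φ).val.toRingHom

theorem isEquivariantHom_inducedEval (σ : H →* (B ≃ₐ[S] B)) (φ : H →* G) :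
    IsEquivariantHom φ (RingHom.id S) (inducedAction σ φ) σ (inducedEval σ φ) where
  map_action h f := by
    change f.1 (1 * φ h) = σ h (f.1 1)
    rw [← f.2, one_mul, mul_one]
  map_algebraMap _ := rfl

section ExtendByZero

variable (σ : H →* (B ≃ₐ[S] B)) {φ : H →* G} (hφ : Function.Injective φ)

/-- The element of the induced algebra supported on the subgroup `φ.range` with value `a` at the
identity. -/
noncomputable def extendByZero (a : B) : inducedSubalgebra σ φ :=
  ⟨Function.extend φ (fun h => σ h a) 0, fun h g => by
    by_cases hg : ∃ h', φ h' = g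
    · obtain ⟨h', rfl⟩ := hg
      rw [← map_mul, hφ.extend_apply, hφ.extend_apply, map_mul, AlgEquiv.mul_apply]
    · have hhg : ¬ ∃ h', φ h' = φ h * g := fun ⟨h', e⟩ => hg ⟨h⁻¹ * h', by simp [e]⟩
      rw [Function.extend_apply' _ _ _ hg, Function.extend_apply' _ _ _ hhg]
      exact (map_zero (σ h)).symm⟩

theorem extendByZero_apply (a : B) (h : H) : (extendByZero σ hφ a).1 (φ h) = σ h a :=
  hφ.extend_apply (fun h => σ h a) 0 h

theorem extendByZero_apply_of_notMem (a : B) {g : G} (hg : g ∉ φ.range) :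
    (extendByZero σ hφ a).1 g = 0 :=
  Function.extend_apply' (fun h => σ h a) (0 : G → B) g hg

theorem sum_extendByZero [Fintype G] [Fintype H] (a : B) :
    ∑ g, (extendByZero σ hφ a).1 g = ∑ h, σ h a := by
  refine (Finset.sum_of_injOn φ hφ.injOn (by simp) (fun g _ hg => ?_) fun h _ => ?_).symm
  · exact extendByZero_apply_of_notMem σ hφ a fun ⟨h, hh⟩ => hg ⟨h, by simp, hh⟩
  · exact (extendByZero_apply σ hφ a h).symm

open Classical in
theorem IsGaloisCoords.sum_extendByZero_mul {ι : Type*} [Fintype ι] {σ : H →* (B ≃ₐ[S] B)}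
    {x y : ι → B} (hxy : IsGaloisCoords σ x y) (u v : G) :
    ∑ i, (extendByZero σ hφ (x i)).1 u * (extendByZero σ hφ (y i)).1 v =
      if u ∈ φ.range ∧ u = v then 1 else 0 := by
  by_cases hu : u ∈ φ.range
  · by_cases hv : v ∈ φ.range
    · obtain ⟨h, rfl⟩ := hu
      obtain ⟨h', rfl⟩ := hv
      have hsum : ∑ i, σ h (x i) * σ h' (y i) = σ h (∑ i, x i * σ (h⁻¹ * h') (y i)) := by
        rw [map_sum]
        refine Finset.sum_congr rfl fun i _ => ?_
        rw [map_mul, ← AlgEquiv.mul_apply, ← map_mul, mul_inv_cancel_left]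
      simp only [extendByZero_apply, hsum, hxy.sum_mul_apply_eq_ite, inv_mul_eq_one, hφ.eq_iff,
        apply_ite (σ h), map_one, map_zero, MonoidHom.mem_range, exists_apply_eq_apply, true_and]
    · have huv : u ≠ v := fun e => hv (e ▸ hu)
      simp [extendByZero_apply_of_notMem σ hφ _ hv, huv]
  · simp [extendByZero_apply_of_notMem σ hφ _ hu, hu]

theorem mul_out_mem_iff {N : Subgroup G} {u : G} {r : G ⧸ N} :
    u * r.out ∈ N ↔ r = QuotientGroup.mk u⁻¹ := by
  rw [eq_comm, ← r.out_eq', QuotientGroup.eq, inv_inv, r.out_eq']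

theorem IsGaloisCoords.induced {ι : Type*} [Fintype ι] {σ : H →* (B ≃ₐ[S] B)} {x y : ι → B}
    [Fintype (G ⧸ φ.range)] (hxy : IsGaloisCoords σ x y) :
    IsGaloisCoords (inducedAction σ φ)
      (fun p : (G ⧸ φ.range) × ι => inducedAction σ φ p.1.out (extendByZero σ hφ (x p.2)))
      (fun p => inducedAction σ φ p.1.out (extendByZero σ hφ (y p.2))) := by
  classical
  have key : ∀ g u, ∑ p : (G ⧸ φ.range) × ι, (extendByZero σ hφ (x p.2)).1 (u * p.1.out) *
      (extendByZero σ hφ (y p.2)).1 (u * g * p.1.out) = if g = 1 then 1 else 0 := fun g u => by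
    have huv : ∀ r : G, u * r = u * g * r ↔ g = 1 := fun r => by simp
    rw [Fintype.sum_prod_type]
    simp only [hxy.sum_extendByZero_mul hφ, mul_out_mem_iff, huv]
    split_ifs with hg <;> simp [hg]
  refine ⟨Subtype.ext (funext fun u => ?_), fun g hg => Subtype.ext (funext fun u => ?_)⟩
  · simpa [inducedAction_apply] using key 1 u
  · simpa [inducedAction_apply, hg] using key g u

end ExtendByZero

theorem IsGaloisAction.induced [Fintype G] [Fintype H] {σ : H →* (B ≃ₐ[S] B)}
    (hσ : IsGaloisAction σ) {φ : H →* G} (hφ : Function.Injective φ) :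
    IsGaloisAction (inducedAction σ φ) := by
  let := Fintype.ofFinite (G ⧸ φ.range)
  obtain ⟨c, hc⟩ := hσ.exists_trace_eq_one
  obtain ⟨m, x, y, hxy⟩ := hσ.exists_coords
  refine ⟨fun f hf => ?_, ⟨extendByZero σ hφ c, Subtype.ext (funext fun u => ?_)⟩,
    (hxy.induced hφ).exists_fin⟩
  · have hconst : ∀ g, f.1 g = f.1 1 := fun g => by
      conv_rhs => rw [← hf g]
      simp
    obtain ⟨a, ha⟩ := hσ.exists_algebraMap_eq (f.1 1) fun h => by rw [← f.2 h 1, hconst]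
    exact ⟨a, Subtype.ext (funext fun g => ha.trans (hconst g).symm)⟩
  · calc (∑ g, inducedAction σ φ g (extendByZero σ hφ c)).1 u
        = ∑ g, (extendByZero σ hφ c).1 (u * g) := by simp [Finset.sum_apply]
      _ = ∑ g, (extendByZero σ hφ c).1 g := Equiv.sum_comp (Equiv.mulLeft u) _
      _ = 1 := (sum_extendByZero σ hφ c).trans hc

end Induction

section GaloisMap

variable {G H : Type*} {F L : Type u} [Group G] [Group H] [Field F] [CommRing L] [Algebra F L]
  {ρ : G →* (L ≃ₐ[F] L)} {φ : H →* G}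

/-! ### Galois actions over a field -/

theorem galoisMap_tmul (ρ : G →* (L ≃ₐ[F] L)) (a b : L) (g : G) :
    galoisMap ρ (a ⊗ₜ b) g = a * ρ g b := by
  simp [galoisMap]

theorem exists_algebraMap_eq_of_tmul_one_eq [Nontrivial L] {x : L}
    (h : x ⊗ₜ[F] (1 : L) = 1 ⊗ₜ x) : ∃ a, algebraMap F L a = x := by
  obtain ⟨f, hf⟩ := Module.Projective.exists_dual_ne_zero F (one_ne_zero (α := L))
  have hfx : f x • (1 : L) = f 1 • x := by
    simpa using (congrArg (TensorProduct.lid F L ∘ f.rTensor L) h)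
  refine ⟨(f 1)⁻¹ * f x, ?_⟩
  rw [Algebra.algebraMap_eq_smul_one, mul_smul, hfx, inv_smul_smul₀ hf]

theorem exists_isGaloisCoords_of_surjective_galoisMap (h : Function.Surjective (galoisMap ρ)) :
    ∃ (m : ℕ) (x y : Fin m → L), IsGaloisCoords ρ x y := by
  classical
  obtain ⟨w, hw⟩ := h (Pi.single 1 1)
  obtain ⟨s, rfl⟩ := TensorProduct.exists_finset w
  have hsum : ∀ g, ∑ p : s, p.1.1 * ρ g p.1.2 = (Pi.single 1 1 : G → L) g := fun g => by
    rw [← hw, map_sum, Finset.sum_apply, Finset.sum_coe_sort s fun p => p.1 * ρ g p.2]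
    simp only [galoisMap_tmul]
  exact IsGaloisCoords.exists_fin (x := fun p : s => p.1.1) (y := fun p : s => p.1.2)
    ⟨by simpa using hsum 1, fun g hg => by simpa [hg] using hsum g⟩

theorem isGaloisAction_of_bijective_galoisMap [Fintype G] [Nontrivial L]
    (h : Function.Bijective (galoisMap ρ)) : IsGaloisAction ρ := by
  have hfix : ∀ x : L, (∀ g, ρ g x = x) → ∃ a, algebraMap F L a = x := fun x hx =>
    exists_algebraMap_eq_of_tmul_one_eq <| h.1 <| funext fun g => by
      rw [galoisMap_tmul, galoisMap_tmul, hx, map_one, mul_one, one_mul]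
  obtain ⟨m, x, y, hxy⟩ := exists_isGaloisCoords_of_surjective_galoisMap h.2
  refine ⟨hfix, ?_, m, x, y, hxy⟩
  obtain ⟨i, -, hi⟩ :=
    Finset.exists_ne_zero_of_sum_ne_zero ((hxy.sum_mul_trace 1).trans_ne one_ne_zero)
  obtain ⟨a, ha⟩ := hfix _ fun g => apply_sum_action ρ g (y i * 1)
  have ha0 : a ≠ 0 := by
    rintro rfl
    exact hi (by rw [← ha, map_zero, mul_zero])
  refine ⟨a⁻¹ • (y i * 1), ?_⟩
  simp only [map_smul, ← Finset.smul_sum, ← ha]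
  rw [inv_smul_eq_iff₀ ha0, Algebra.algebraMap_eq_smul_one]

theorem IsGaloisAction.eq_sum_galoisMap_tmul [Fintype G] (hρ : IsGaloisAction ρ) {ι : Type*}
    [Fintype ι] {x y : ι → L} (hxy : IsGaloisCoords ρ x y) (w : L ⊗[F] L) :
    w = ∑ i, (∑ g, ρ g (y i) * galoisMap ρ w g) ⊗ₜ[F] x i := by
  induction w using TensorProduct.induction_on with
  | zero => simp
  | tmul a b =>
    conv_lhs => rw [← hxy.sum_mul_trace b, TensorProduct.tmul_sum]
    refine Finset.sum_congr rfl fun i _ => ?_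
    obtain ⟨c, hc⟩ := hρ.exists_algebraMap_eq_trace (y i * b)
    have hca : c • a = ∑ g, ρ g (y i) * galoisMap ρ (a ⊗ₜ b) g := by
      rw [Algebra.smul_def, hc, Finset.sum_mul]
      refine Finset.sum_congr rfl fun g _ => ?_
      rw [galoisMap_tmul, map_mul]
      ring
    rw [← hca, TensorProduct.smul_tmul, Algebra.smul_def, hc, mul_comm]
  | add a b ha hb =>
    conv_lhs => rw [ha, hb]
    simp only [map_add, Pi.add_apply, mul_add, Finset.sum_add_distrib, TensorProduct.add_tmul]

theorem IsGaloisAction.bijective_galoisMap [Fintype G] (hρ : IsGaloisAction ρ) :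
    Function.Bijective (galoisMap ρ) := by
  classical
  obtain ⟨m, x, y, hxy⟩ := hρ.exists_coords
  constructor
  · rw [injective_iff_map_eq_zero]
    intro w hw
    rw [hρ.eq_sum_galoisMap_tmul hxy w, hw]
    simp
  · intro f
    refine ⟨∑ u, ∑ i, (f u * x i) ⊗ₜ ρ u⁻¹ (y i), funext fun g => ?_⟩
    simp only [map_sum, Finset.sum_apply, galoisMap_tmul, mul_assoc, ← Finset.mul_sum]
    simp only [← AlgEquiv.mul_apply, ← map_mul, hxy.sum_mul_apply_eq_ite, mul_inv_eq_one]
    simp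

/-! ### The degree of the invariants of a subgroup -/

variable (ρ φ)

/-- The analogue `L ⊗[F] L^H → (G ⧸ H → L)` of `galoisMap` for the `G`-set `G ⧸ H`, where
`H = φ.range`, in terms of representatives of the cosets. -/
noncomputable def invariantsGaloisMap :
    L ⊗[F] invariantSubalgebra ρ φ →ₗ[F] (G ⧸ φ.range → L) where
  toFun w r := galoisMap ρ ((invariantSubalgebra ρ φ).val.toLinearMap.lTensor L w) r.out
  map_add' a b := by ext; simp
  map_smul' a b := by ext; simp

theorem galoisMap_lTensor_val (w : L ⊗[F] invariantSubalgebra ρ φ) (g : G) :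
    galoisMap ρ ((invariantSubalgebra ρ φ).val.toLinearMap.lTensor L w) g =
      invariantsGaloisMap ρ φ w (QuotientGroup.mk g) := by
  obtain ⟨⟨_, h, rfl⟩, hh⟩ := QuotientGroup.mk_out_eq_mul φ.range g
  change _ = galoisMap ρ _ (Quotient.out (QuotientGroup.mk g))
  rw [hh]
  induction w using TensorProduct.induction_on with
  | zero => simp
  | tmul a b => simp [galoisMap_tmul, b.2 h]
  | add a b ha hb => simp only [map_add, Pi.add_apply, ha, hb]

/-- The trace `L → L^H` of the restriction of the action to `H`. -/
def invariantTrace [Fintype H] : L →ₗ[F] invariantSubalgebra ρ φ where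
  toFun x := ⟨∑ h, ρ (φ h) x, fun h => apply_sum_action (ρ.comp φ) h x⟩
  map_add' a b := Subtype.ext (by simp [Finset.sum_add_distrib])
  map_smul' a b := Subtype.ext (by simp [Finset.smul_sum])

theorem invariantsGaloisMap_lTensor_invariantTrace [Fintype H] (w : L ⊗[F] L)
    (r : G ⧸ φ.range) :
    invariantsGaloisMap ρ φ ((invariantTrace ρ φ).lTensor L w) r =
      ∑ h, galoisMap ρ w (r.out * φ h) := by
  induction w using TensorProduct.induction_on with
  | zero => simp
  | tmul a b =>
    have hsum : a * ρ r.out (∑ h, ρ (φ h) b) = ∑ h, a * ρ (r.out * φ h) b := by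
      simp [Finset.mul_sum]
    simp only [galoisMap_tmul, ← hsum]
    exact galoisMap_tmul ρ a _ _
  | add a b ha hb => simp only [map_add, Pi.add_apply, Finset.sum_add_distrib, ha, hb]

variable {ρ φ}

theorem IsGaloisAction.bijective_invariantsGaloisMap [Fintype G] [Finite H]
    (hρ : IsGaloisAction ρ) (hφ : Function.Injective φ) :
    Function.Bijective (invariantsGaloisMap ρ φ) := by
  classical
  let := Fintype.ofFinite H
  constructor
  · rw [injective_iff_map_eq_zero]
    intro w hw
    have hval : Function.Injective ((invariantSubalgebra ρ φ).val.toLinearMap.lTensor L) :=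
      Module.Flat.lTensor_preserves_injective_linearMap _ Subtype.val_injective
    refine hval (hρ.bijective_galoisMap.1 (funext fun g => ?_))
    rw [galoisMap_lTensor_val, hw]
    simp
  · intro f
    obtain ⟨w, hw⟩ := hρ.bijective_galoisMap.2
      fun g => if g = (QuotientGroup.mk g : G ⧸ φ.range).out then f (QuotientGroup.mk g) else 0
    refine ⟨(invariantTrace ρ φ).lTensor L w, funext fun r => ?_⟩
    have hmk : ∀ h, (QuotientGroup.mk (r.out * φ h) : G ⧸ φ.range) = r := fun h =>
      (QuotientGroup.mk_mul_of_mem r.out (MonoidHom.mem_range.2 ⟨h, rfl⟩)).trans r.out_eq'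
    simp [invariantsGaloisMap_lTensor_invariantTrace, hw, hmk, map_eq_one_iff φ hφ]

theorem IsGaloisAction.finrank_invariantSubalgebra [Fintype G] [Finite H] [Nontrivial L]
    (hρ : IsGaloisAction ρ) (hφ : Function.Injective φ) :
    Module.finrank F (invariantSubalgebra ρ φ) = φ.range.index := by
  have := hρ.finite
  let := Fintype.ofFinite (G ⧸ φ.range)
  have h := (LinearEquiv.ofBijective _ (hρ.bijective_invariantsGaloisMap hφ)).finrank_eq
  rw [Module.finrank_tensorProduct, Module.finrank_pi_fintype, Finset.sum_const, Finset.card_univ,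
    smul_eq_mul, mul_comm] at h
  rw [Nat.eq_of_mul_eq_mul_right Module.finrank_pos h, Subgroup.index, Nat.card_eq_fintype_card]

end GaloisMap

section FiniteAlgebra

variable {F A : Type*} [Field F] [CommRing A] [Algebra F A] [Module.Finite F A] {l : ℕ}

/-! ### Residue fields of finite algebras -/

theorem dvd_finrank_of_forall_isPrime (hl : ∀ p : Ideal A, p.IsPrime → l ∣ Module.finrank F (A ⧸ p))
    (N : Type*) [AddCommGroup N] [Module A N] [Module.Finite A N] [Module F N]
    [IsScalarTower F A N] : l ∣ Module.finrank F N := by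
  have : IsNoetherianRing A := isNoetherian_of_tower F inferInstance
  refine IsNoetherianRing.induction_on_isQuotientEquivQuotientPrime A (M := N) ‹_›
    (motive := fun N _ _ _ => ∀ [Module F N] [IsScalarTower F A N], l ∣ Module.finrank F N)
    ?_ ?_ ?_
  · intro N _ _ _ _ _ _
    rw [Module.finrank_zero_of_subsingleton]
    exact dvd_zero l
  · intro N _ _ _ p e _ _
    rw [(e.restrictScalars F).finrank_eq]
    exact hl p.1 p.2
  · intro N₁ _ _ _ N₂ _ _ _ N₃ _ _ _ f g hf hg hfg h1 h3 _ _
    let := Module.compHom N₁ (algebraMap F A)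
    let := Module.compHom N₃ (algebraMap F A)
    have : IsScalarTower F A N₁ := .of_algebraMap_smul fun _ _ => rfl
    have : IsScalarTower F A N₃ := .of_algebraMap_smul fun _ _ => rfl
    have : Module.Finite F N₂ := Module.Finite.trans A N₂
    have hrange : Module.finrank F (LinearMap.range (g.restrictScalars F)) =
        Module.finrank F N₃ := by
      rw [LinearMap.range_eq_top.2 (by exact hg), finrank_top]
    have hker : Module.finrank F (LinearMap.ker (g.restrictScalars F)) =
        Module.finrank F N₁ := by
      have e : LinearMap.ker (g.restrictScalars F) = LinearMap.range (f.restrictScalars F) :=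
        SetLike.ext hfg
      rw [e, LinearMap.finrank_range_of_inj (by exact hf)]
    rw [← (g.restrictScalars F).finrank_range_add_finrank_ker, hrange, hker]
    exact dvd_add h3 h1

theorem exists_isMaximal_not_dvd_finrank (h : ¬ l ∣ Module.finrank F A) :
    ∃ m : Ideal A, m.IsMaximal ∧ ¬ l ∣ Module.finrank F (A ⧸ m) := by
  by_contra! hm
  have : IsArtinianRing A := IsArtinianRing.of_finite F A
  exact h (dvd_finrank_of_forall_isPrime (fun p _ => hm p inferInstance) A)

end FiniteAlgebra

/-! ### Galois algebras and their reductions to subgroups -/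

namespace GaloisAlgebra

variable {G : Type v} [Group G] {F E : Type u} [Field F] [Field E] [Algebra F E]

theorem isGaloisAction [Fintype G] (t : GaloisAlgebra G F) : IsGaloisAction t.action :=
  haveI := t.nontrivial
  isGaloisAction_of_bijective_galoisMap t.bijective

theorem algebraMap_injective (t : GaloisAlgebra G F) :
    Function.Injective (algebraMap F t.carrier) :=
  haveI := t.nontrivial
  FaithfulSMul.algebraMap_injective F t.carrier

/-- The `G`-torsor given by a Galois action on a nonzero algebra. -/
def ofIsGaloisAction [Fintype G] {L : Type u} [CommRing L] [Algebra F L] [Nontrivial L]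
    {ρ : G →* (L ≃ₐ[F] L)} (hρ : IsGaloisAction ρ) : GaloisAlgebra G F where
  carrier := L
  nontrivial := inferInstance
  action := ρ
  bijective := hρ.bijective_galoisMap

/-- The base change of a `G`-torsor along a field extension. -/
noncomputable def baseChange [Finite G] (t : GaloisAlgebra G F) (E : Type u) [Field E]
    [Algebra F E] : GaloisAlgebra G E :=
  letI := Fintype.ofFinite G
  haveI := t.nontrivial
  ofIsGaloisAction (t.isGaloisAction.baseChange E)

theorem exists_isEquivariantHom_baseChange [Finite G] (t : GaloisAlgebra G F) (E : Type u) [Field E]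
    [Algebra F E] :
    ∃ f : t.carrier →+* (t.baseChange E).carrier, IsEquivariantHom (MonoidHom.id G)
      (algebraMap F E) t.action (t.baseChange E).action f :=
  ⟨_, isEquivariantHom_includeRight t.action E⟩

theorem exists_algEquiv_of_isEquivariantHom [Finite G] {t : GaloisAlgebra G F}
    {a : GaloisAlgebra G E} {f : t.carrier →+* a.carrier}
    (hf : IsEquivariantHom (MonoidHom.id G) (algebraMap F E) t.action a.action f) :
    ∃ e : (E ⊗[F] t.carrier) ≃ₐ[E] a.carrier,
      ∀ g x, e (t.baseAction E g x) = a.action g (e x) := by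
  let := Fintype.ofFinite G
  obtain ⟨f', hf'⟩ := hf.exists_lift (j := RingHom.id E)
  have hbij := (t.isGaloisAction.baseChange E).bijective_of_isEquivariantHom a.isGaloisAction
    a.algebraMap_injective hf'
  exact ⟨AlgEquiv.ofBijective { f' with commutes' := hf'.map_algebraMap } hbij, hf'.map_action⟩

theorem sameOver_of_isEquivariantHom [Finite G] {M : Type u} [Field M] [Algebra M E]
    {t : GaloisAlgebra G F} {s : GaloisAlgebra G M} {a : GaloisAlgebra G E}
    {f : t.carrier →+* a.carrier} {f' : s.carrier →+* a.carrier}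
    (hf : IsEquivariantHom (MonoidHom.id G) (algebraMap F E) t.action a.action f)
    (hf' : IsEquivariantHom (MonoidHom.id G) (algebraMap M E) s.action a.action f') :
    t.SameOver s E := by
  obtain ⟨e, he⟩ := exists_algEquiv_of_isEquivariantHom hf
  obtain ⟨e', he'⟩ := exists_algEquiv_of_isEquivariantHom hf'
  refine ⟨e'.trans e.symm, fun g x => e.injective ?_⟩
  simp only [AlgEquiv.trans_apply, AlgEquiv.apply_symm_apply, he, he']

theorem SameOver.exists_isEquivariantHom [Finite G] {M : Type u} [Field M] [Algebra M E]
    {t : GaloisAlgebra G F} {s : GaloisAlgebra G M} (h : t.SameOver s E) :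
    ∃ f : s.carrier →+* (t.baseChange E).carrier, IsEquivariantHom (MonoidHom.id G)
      (algebraMap M E) s.action (t.baseChange E).action f := by
  obtain ⟨e, he⟩ := h
  have hequiv : IsEquivariantHom (MonoidHom.id G) (RingHom.id E) (s.baseChange E).action
      (t.baseChange E).action (e : E ⊗[M] s.carrier →+* E ⊗[F] t.carrier) :=
    ⟨he, e.commutes⟩
  exact ⟨_, hequiv.comp (isEquivariantHom_includeRight s.action E)⟩

end GaloisAlgebra

namespace GaloisAlgebra

variable {G H : Type} [Group G] [Group H] [Finite G] [Finite H] {F E : Type u} [Field F] [Field E]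
  [Algebra F E] {φ : H →* G}

/-- The `G`-torsor induced from an `H`-torsor along an injective homomorphism. -/
noncomputable def induced (s : GaloisAlgebra H F) (hφ : Function.Injective φ) :
    GaloisAlgebra G F :=
  letI := Fintype.ofFinite G
  letI := Fintype.ofFinite H
  haveI := s.nontrivial
  ofIsGaloisAction (s.isGaloisAction.induced hφ)

theorem SameOver.induced (hφ : Function.Injective φ) {M E' : Type u} [Field M] [Field E']
    [Algebra F E'] [Algebra E E'] [IsScalarTower F E E'] [Algebra M E'] {t : GaloisAlgebra G F}
    {s : GaloisAlgebra H E} {s' : GaloisAlgebra H M} {f : t.carrier →+* s.carrier}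
    (h : s.SameOver s' E') (hf : IsEquivariantHom φ (algebraMap F E) t.action s.action f) :
    t.SameOver (s'.induced hφ) E' := by
  obtain ⟨i, hi⟩ := s.exists_isEquivariantHom_baseChange E'
  obtain ⟨i', hi'⟩ := h.exists_isEquivariantHom
  have hif := hi.comp hf
  rw [← IsScalarTower.algebraMap_eq F E E'] at hif
  obtain ⟨F₁, hF₁⟩ := hif.exists_induced
  obtain ⟨F₂, hF₂⟩ := (hi'.comp (isEquivariantHom_inducedEval s'.action φ)).exists_induced
  exact sameOver_of_isEquivariantHom (a := (s.baseChange E').induced hφ) hF₁ hF₂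

/-- The reduction of a `G`-torsor to `H` given by an `N`-point of its quotient by `H`. -/
noncomputable def reduction (t : GaloisAlgebra G F) (hφ : Function.Injective φ) (N : Type u)
    [Field N] [Algebra (invariantSubalgebra t.action φ) N] : GaloisAlgebra H N :=
  letI := Fintype.ofFinite G
  letI := Fintype.ofFinite H
  haveI := (t.isGaloisAction.restrict hφ).nontrivial_baseChange N Subtype.val_injective
  ofIsGaloisAction ((t.isGaloisAction.restrict hφ).baseChange N)

/-- The given map determines an `E`-point of the quotient of `t` by `H`, and since that quotient is
finite over `F`, the point is already defined over the algebraic closure of `F` in `E`. -/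
theorem exists_isEquivariantHom_algebraicClosure (hφ : Function.Injective φ)
    {t : GaloisAlgebra G F} {b : GaloisAlgebra H E} {f : t.carrier →+* b.carrier}
    (hf : IsEquivariantHom φ (algebraMap F E) t.action b.action f) :
    ∃ (s : GaloisAlgebra H (algebraicClosure F E)) (f' : s.carrier →+* b.carrier),
      IsEquivariantHom (MonoidHom.id H) (algebraMap (algebraicClosure F E) E)
        s.action b.action f' := by
  let := Fintype.ofFinite G
  let := Fintype.ofFinite H
  obtain ⟨ψ, hψf, hψ⟩ := hf.exists_invariants b.isGaloisAction b.algebraMap_injective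
  let ψF : invariantSubalgebra t.action φ →ₐ[F] E :=
    { ψ with commutes' := fun a => RingHom.congr_fun hψ a }
  have := t.isGaloisAction.finite
  have hmem : ∀ a, ψ a ∈ algebraicClosure F E := fun a =>
    mem_algebraicClosure_iff.2
      ((Algebra.IsIntegral.isIntegral (R := F) a).map ψF).isAlgebraic
  let := (ψ.codRestrict (algebraicClosure F E) hmem).toAlgebra
  obtain ⟨f', hf'⟩ := IsEquivariantHom.exists_lift (R' := algebraicClosure F E)
    (j := algebraMap (algebraicClosure F E) E) hψf
  exact ⟨t.reduction hφ (algebraicClosure F E), f', hf'⟩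

theorem exists_isEquivariantHom_of_not_dvd_index (t : GaloisAlgebra G F)
    (hφ : Function.Injective φ) {l : ℕ} (hl : ¬ l ∣ φ.range.index) :
    ∃ (E : Type u) (_ : Field E) (_ : Algebra F E) (s : GaloisAlgebra H E)
      (f : t.carrier →+* s.carrier), FiniteDimensional F E ∧ ¬ l ∣ Module.finrank F E ∧
        IsEquivariantHom φ (algebraMap F E) t.action s.action f := by
  let := Fintype.ofFinite G
  have := t.nontrivial
  have := t.isGaloisAction.finite
  rw [← t.isGaloisAction.finrank_invariantSubalgebra hφ] at hl
  obtain ⟨m, hm, hmd⟩ := exists_isMaximal_not_dvd_finrank hl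
  let E := invariantSubalgebra t.action φ ⧸ m
  let : Field E := Ideal.Quotient.field m
  exact ⟨E, _, inferInstance, t.reduction hφ E, _, inferInstance, hmd,
    (isEquivariantHom_includeRight (restrictAction t.action φ) E).comp
      (isEquivariantHom_restrictAction t.action φ)⟩

end GaloisAlgebra

/-! ### Comparison of essential dimensions -/

theorem GaloisAlgebra.essDim_le_trdeg {G : Type v} [Group G] {k F E : Type u} [Field k] [Field F]
    [Field E] [Algebra k F] [Algebra k E] [Algebra F E] [IsScalarTower k F E]
    [FiniteDimensional F E] {l : ℕ} (hl : ¬ l ∣ Module.finrank F E) {t : GaloisAlgebra G F}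
    {M : IntermediateField k E} {s : GaloisAlgebra G M} (hs : t.SameOver s E) :
    t.essDim k l ≤ Cardinal.toENat (Algebra.trdeg k M) := by
  unfold GaloisAlgebra.essDim
  exact iInf_le_of_le E <| iInf_le_of_le _ <| iInf_le_of_le _ <| iInf_le_of_le _ <|
    iInf_le_of_le ‹IsScalarTower k F E› <| iInf_le_of_le ‹FiniteDimensional F E› <|
      iInf_le_of_le hl <| iInf_le_of_le M <| iInf_le_of_le ⟨s, hs⟩ le_rfl

theorem GaloisAlgebra.essDim_le_essDim {G : Type v} [Group G] {k F : Type u} [Field k] [Field F]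
    [Algebra k F] (t : GaloisAlgebra G F) (l : ℕ) : t.essDim k l ≤ _root_.essDim k G l := by
  unfold _root_.essDim
  exact le_iSup_of_le F <| le_iSup_of_le _ <| le_iSup_of_le _ <| le_iSup_of_le t le_rfl

theorem trdeg_restrictScalars_algebraicClosure {k E : Type*} [Field k] [Field E] [Algebra k E]
    (M : IntermediateField k E) :
    Algebra.trdeg k ((algebraicClosure M E).restrictScalars k) = Algebra.trdeg k M := by
  have : FaithfulSMul M (algebraicClosure M E) :=
    (faithfulSMul_iff_algebraMap_injective _ _).2 (algebraMap M (algebraicClosure M E)).injective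
  have := trdeg_add_eq k M (A := algebraicClosure M E)
  rw [trdeg_eq_zero (R := M) (A := algebraicClosure M E), add_zero] at this
  exact this.symm

section Comparison

variable {G H : Type} [Group G] [Group H] {φ : H →* G} (k : Type u) [Field k]

theorem essDim_le_of_injective [Finite G] [Finite H] (hφ : Function.Injective φ) (l : ℕ) :
    essDim k H l ≤ essDim k G l := by
  refine iSup_le fun F => iSup_le fun _ => iSup_le fun _ => iSup_le fun s =>
    le_trans ?_ ((s.induced hφ).essDim_le_essDim l)
  refine le_iInf fun E => le_iInf fun _ => le_iInf fun _ => le_iInf fun _ => le_iInf fun _ =>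
    le_iInf fun _ => le_iInf fun hl => le_iInf fun M => le_iInf fun ⟨t, ht⟩ => ?_
  rw [← trdeg_restrictScalars_algebraicClosure M]
  obtain ⟨f, hf⟩ := ht.exists_isEquivariantHom
  obtain ⟨i, hi⟩ := s.exists_isEquivariantHom_baseChange E
  have heval : IsEquivariantHom φ (algebraMap F E) (s.induced hφ).action (s.baseChange E).action
      (i.comp (inducedEval s.action φ)) :=
    hi.comp (isEquivariantHom_inducedEval s.action φ)
  obtain ⟨i', hi'⟩ := heval.exists_lift (R' := E) (j := RingHom.id E)
  have hres := hi'.comp hf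
  obtain ⟨s', f', hf'⟩ := GaloisAlgebra.exists_isEquivariantHom_algebraicClosure hφ hres
  exact GaloisAlgebra.essDim_le_trdeg hl
    (GaloisAlgebra.sameOver_of_isEquivariantHom hi hf')

theorem essDim_le_of_not_dvd_index [Finite G] [Finite H] (hφ : Function.Injective φ) {l : ℕ}
    (hl : l.Prime) (hi : ¬ l ∣ φ.range.index) : essDim k G l ≤ essDim k H l := by
  refine iSup_le fun F => iSup_le fun _ => iSup_le fun _ => iSup_le fun t => ?_
  obtain ⟨E, _, _, s, f, _, hE, hf⟩ := t.exists_isEquivariantHom_of_not_dvd_index hφ hi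
  let : Algebra k E := ((algebraMap F E).comp (algebraMap k F)).toAlgebra
  have : IsScalarTower k F E := .of_algebraMap_eq fun _ => rfl
  refine le_trans ?_ (s.essDim_le_essDim l)
  refine le_iInf fun E' => le_iInf fun _ => le_iInf fun _ => le_iInf fun _ => le_iInf fun _ =>
    le_iInf fun _ => le_iInf fun hE' => le_iInf fun M => le_iInf fun ⟨s', hs'⟩ => ?_
  let : Algebra F E' := ((algebraMap E E').comp (algebraMap F E)).toAlgebra
  have : IsScalarTower F E E' := .of_algebraMap_eq fun _ => rfl
  have : IsScalarTower k F E' := .of_algebraMap_eq fun a =>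
    IsScalarTower.algebraMap_apply k E E' a
  have : FiniteDimensional F E' := FiniteDimensional.trans F E E'
  refine GaloisAlgebra.essDim_le_trdeg ?_ (hs'.induced hφ hf)
  rw [← Module.finrank_mul_finrank F E E', hl.dvd_mul]
  exact not_or.2 ⟨hE, hE'⟩

theorem essDim_eq_of_not_dvd_index [Finite G] (hφ : Function.Injective φ) {l : ℕ}
    (hl : l.Prime) (hi : ¬ l ∣ φ.range.index) : essDim k H l = essDim k G l :=
  have := Finite.of_injective φ hφ
  le_antisymm (essDim_le_of_injective k hφ l) (essDim_le_of_not_dvd_index k hφ hl hi)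

end Comparison

section Conjugation

/-! ### Quadratic extensions of finite fields -/

theorem natCard_pow_eq_of_isCyclic {G : Type*} [CommGroup G] [IsCyclic G] [Finite G] {m n : ℕ}
    (hG : Nat.card G = m * n) {a : G} (ha : a ^ n = 1) : Nat.card {b : G // b ^ m = a} = m := by
  have hmn : m * n ≠ 0 := hG ▸ Nat.card_pos.ne'
  have hm : (m * n).gcd m = m := Nat.gcd_eq_right (Dvd.intro n rfl)
  have hn : (m * n).gcd n = n := Nat.gcd_eq_right (Dvd.intro_left m rfl)
  have hrange : (powMonoidHom m : G →* G).range = (powMonoidHom n : G →* G).ker := by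
    refine Subgroup.eq_of_le_of_card_ge ?_ ?_
    · rintro _ ⟨b, rfl⟩
      simp [MonoidHom.mem_ker, ← pow_mul, ← hG]
    · rw [IsCyclic.card_powMonoidHom_ker, IsCyclic.card_powMonoidHom_range, hG, hm, hn,
        Nat.mul_div_cancel_left n (Nat.pos_of_ne_zero (left_ne_zero_of_mul hmn))]
  obtain ⟨b, rfl⟩ : a ∈ (powMonoidHom m : G →* G).range := hrange ▸ MonoidHom.mem_ker.2 ha
  exact (Nat.card_congr ((powMonoidHom m : G →* G).fiberEquivKer b)).trans
    (by rw [IsCyclic.card_powMonoidHom_ker, hG, hm])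

/-- `σ` is the involution `a ↦ a ^ q` of a field with `q ^ 2` elements, the nontrivial automorphism
over the subfield with `q` elements. -/
structure IsConjugation {K : Type*} [Field K] (q : ℕ) (σ : K →+* K) : Prop where
  card_eq : Nat.card K = q ^ 2
  one_lt : 1 < q
  apply_eq : ∀ a, σ a = a ^ q

theorem isConjugation_conjFq (p r : ℕ) [Fact p.Prime] (hr : 0 < r) :
    IsConjugation (p ^ r) (conjFq p r) where
  card_eq := by rw [GaloisField.card p (2 * r) (by lia), ← pow_mul, mul_comm]
  one_lt := Nat.one_lt_pow hr.ne' (Fact.out : p.Prime).one_lt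
  apply_eq := iterateFrobenius_def p r

variable {K : Type*} [Field K] {q : ℕ} {σ : K →+* K}

namespace IsConjugation

theorem finite (hσ : IsConjugation q σ) : Finite K :=
  Nat.finite_of_card_ne_zero (hσ.card_eq ▸ pow_ne_zero 2 (Nat.ne_zero_of_lt hσ.one_lt))

theorem apply_apply (hσ : IsConjugation q σ) (a : K) : σ (σ a) = a := by
  have := hσ.finite
  let := Fintype.ofFinite K
  rw [hσ.apply_eq, hσ.apply_eq, ← pow_mul, ← sq, ← hσ.card_eq, Nat.card_eq_fintype_card,
    FiniteField.pow_card]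

theorem mul_apply (hσ : IsConjugation q σ) (a : K) : a * σ a = a ^ (q + 1) := by
  rw [hσ.apply_eq, pow_succ']

theorem natCard_units (hσ : IsConjugation q σ) : Nat.card Kˣ = (q + 1) * (q - 1) := by
  rw [Nat.card_units, hσ.card_eq, ← Nat.sq_sub_sq, one_pow]

theorem units_pow_sub_one (hσ : IsConjugation q σ) {u : Kˣ} (hu : σ u = u) :
    u ^ (q - 1) = 1 := by
  refine mul_right_cancel (b := u) ?_
  rw [← pow_succ, Nat.sub_add_cancel hσ.one_lt.le, one_mul]
  exact Units.ext (by rw [Units.val_pow_eq_pow_val, ← hσ.apply_eq, hu])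

theorem exists_apply_ne (hσ : IsConjugation q σ) : ∃ a, σ a ≠ a := by
  by_contra! h
  have := hσ.finite
  have hexp : Monoid.exponent Kˣ ∣ q - 1 :=
    Monoid.exponent_dvd_of_forall_pow_eq_one fun u => hσ.units_pow_sub_one (h u)
  rw [IsCyclic.exponent_eq_card, hσ.natCard_units] at hexp
  have hq := Nat.sub_pos_of_lt hσ.one_lt
  have hle : q + 1 ≤ 1 :=
    Nat.le_of_mul_le_mul_right (by simpa only [one_mul] using Nat.le_of_dvd hq hexp) hq
  lia

theorem exists_mul_add_apply_ne_zero (hσ : IsConjugation q σ) {z : K} (hz : z ≠ 0) :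
    ∃ c, c * z + σ (c * z) ≠ 0 := by
  by_contra! h
  have htrace : ∀ a, a + σ a = 0 := fun a => by
    simpa [div_mul_cancel₀ a hz] using h (a / z)
  obtain ⟨a, ha⟩ := hσ.exists_apply_ne
  have hone := htrace 1
  rw [map_one] at hone
  exact ha (by linear_combination htrace a - a * hone)

theorem natCard_mul_apply_eq (hσ : IsConjugation q σ) {c : K} (hc : σ c = c) (hc0 : c ≠ 0) :
    Nat.card {a : K // a * σ a = c} = q + 1 := by
  have := hσ.finite
  rw [← natCard_pow_eq_of_isCyclic hσ.natCard_units
    (hσ.units_pow_sub_one (u := Units.mk0 c hc0) hc)]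
  refine Nat.card_congr
    { toFun := fun a => ⟨Units.mk0 a.1 fun h => hc0 ?_, Units.ext ?_⟩
      invFun := fun u => ⟨u.1, ?_⟩
      left_inv := fun a => rfl
      right_inv := fun u => Subtype.ext (Units.ext rfl) }
  · rw [← a.2, h, zero_mul]
  · exact (hσ.mul_apply a.1).symm.trans a.2
  · exact (hσ.mul_apply u.1).trans (congrArg Units.val u.2)

theorem exists_mul_apply_eq (hσ : IsConjugation q σ) {c : K} (hc : σ c = c) (hc0 : c ≠ 0) :
    ∃ a, a * σ a = c := by
  have hcard := hσ.natCard_mul_apply_eq hc hc0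
  obtain ⟨⟨a, ha⟩⟩ : Nonempty {a : K // a * σ a = c} := (Nat.card_pos_iff.1 (by lia)).1
  exact ⟨a, ha⟩

open Classical in
theorem natCard_mul_apply_eq_add_ite (hσ : IsConjugation q σ) {c : K} (hc : σ c = c) :
    Nat.card {a : K // a * σ a = c} + (if c = 0 then q else 0) = q + 1 := by
  split_ifs with hc0
  · have : Unique {a : K // a * σ a = c} :=
      ⟨⟨⟨0, by simp [hc0]⟩⟩, fun a => Subtype.ext (by simpa [hc0] using a.2)⟩
    rw [Nat.card_unique, add_comm]
  · rw [hσ.natCard_mul_apply_eq hc hc0, add_zero]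

theorem apply_sum_mul_apply (hσ : IsConjugation q σ) {ι : Type*} [Fintype ι] (x : ι → K) :
    σ (∑ i, x i * σ (x i)) = ∑ i, x i * σ (x i) := by
  simp only [map_sum, map_mul, hσ.apply_apply, mul_comm]

/-- Project away the first coordinate: the size of a fibre of the projection only depends on whether
the remaining coordinates already have length `c`. -/
theorem natCard_sum_mul_apply_eq_succ (hσ : IsConjugation q σ) {c : K} (hc : σ c = c) (n : ℕ) :
    Nat.card {x : Fin (n + 1) → K // ∑ i, x i * σ (x i) = c} +
      q * Nat.card {x : Fin n → K // ∑ i, x i * σ (x i) = c} = (q + 1) * q ^ (2 * n) := by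
  classical
  have := hσ.finite
  let := Fintype.ofFinite K
  let e : {x : Fin (n + 1) → K // ∑ i, x i * σ (x i) = c} ≃
      Σ w : Fin n → K, {a : K // a * σ a = c - ∑ i, w i * σ (w i)} :=
    { toFun := fun x => ⟨Fin.tail x.1, x.1 0,
        eq_sub_of_add_eq ((Fin.sum_univ_succ _).symm.trans x.2)⟩
      invFun := fun p => ⟨Fin.cons p.2.1 p.1, by simp [Fin.sum_univ_succ, p.2.2]⟩
      left_inv := fun x => Subtype.ext (Fin.cons_self_tail x.1)
      right_inv := fun p => rfl }
  have hfib : ∀ w : Fin n → K, Nat.card {a : K // a * σ a = c - ∑ i, w i * σ (w i)} +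
      (if ∑ i, w i * σ (w i) = c then q else 0) = q + 1 := fun w => by
    simpa only [sub_eq_zero, eq_comm (a := c)] using hσ.natCard_mul_apply_eq_add_ite
      (c := c - ∑ i, w i * σ (w i)) (by rw [map_sub, hc, hσ.apply_sum_mul_apply])
  have hvec : Fintype.card (Fin n → K) = q ^ (2 * n) := by
    rw [← Nat.card_eq_fintype_card, Nat.card_fun, hσ.card_eq, Nat.card_fin, pow_mul]
  calc Nat.card {x : Fin (n + 1) → K // ∑ i, x i * σ (x i) = c} +
        q * Nat.card {x : Fin n → K // ∑ i, x i * σ (x i) = c}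
      = ∑ w : Fin n → K, (Nat.card {a : K // a * σ a = c - ∑ i, w i * σ (w i)} +
          if ∑ i, w i * σ (w i) = c then q else 0) := by
        rw [Nat.card_congr e, Nat.card_sigma, Finset.sum_add_distrib, ← Finset.sum_filter,
          Finset.sum_const, smul_eq_mul, mul_comm q,
          Nat.card_eq_fintype_card (α := {x : Fin n → K // _}), Fintype.card_subtype]
    _ = (q + 1) * q ^ (2 * n) := by
        rw [Finset.sum_congr rfl fun w _ => hfib w, Finset.sum_const, Finset.card_univ, hvec,
          smul_eq_mul, mul_comm]

theorem natCard_sum_mul_apply_eq_one (hσ : IsConjugation q σ) (n : ℕ) :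
    (Nat.card {x : Fin (n + 1) → K // ∑ i, x i * σ (x i) = 1} : ℤ) =
      q ^ n * (q ^ (n + 1) - (-1) ^ (n + 1)) := by
  have hrec : ∀ n, (Nat.card {x : Fin (n + 1) → K // ∑ i, x i * σ (x i) = 1} : ℤ) =
      (q + 1) * q ^ (2 * n) - q * Nat.card {x : Fin n → K // ∑ i, x i * σ (x i) = 1} := fun n =>
    eq_sub_of_add_eq (mod_cast hσ.natCard_sum_mul_apply_eq_succ (map_one σ) n)
  induction n with
  | zero =>
    have hempty : Nat.card {x : Fin 0 → K // ∑ i, x i * σ (x i) = 1} = 0 := by simp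
    rw [hrec, hempty]
    ring
  | succ n ih =>
    rw [hrec, ih]
    ring

end IsConjugation

end Conjugation

section OrthonormalFamilies

variable {K V : Type*} [Field K] [AddCommGroup V] [Module K V] {q : ℕ} {σ : K →+* K}
  {B : V →ₗ[K] V →ₛₗ[σ] K}

/-! ### Orthonormal families -/

/-- A family of vectors that is orthonormal for the sesquilinear form `B`. -/
def IsOrthonormalFamily {ι : Type*} [DecidableEq ι] (B : V →ₗ[K] V →ₛₗ[σ] K) (v : ι → V) : Prop :=
  ∀ a b, B (v a) (v b) = if a = b then 1 else 0

theorem isOrthonormalFamily_sumElim_iff {ι κ : Type*} [DecidableEq ι] [DecidableEq κ]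
    (hB : ∀ x y, B y x = σ (B x y)) {v : ι → V} {w : κ → V} :
    IsOrthonormalFamily B (Sum.elim v w) ↔
      IsOrthonormalFamily B v ∧ IsOrthonormalFamily B w ∧ ∀ i a, B (w i) (v a) = 0 := by
  have hflip : (∀ a i, B (v a) (w i) = 0) ↔ ∀ i a, B (w i) (v a) = 0 := by
    rw [forall_comm]
    simp only [hB (v _), map_eq_zero]
  simp only [IsOrthonormalFamily, Sum.forall, Sum.elim_inl, Sum.elim_inr, Sum.inl.injEq,
    Sum.inr.injEq, reduceCtorEq, if_false, forall_and, hflip]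
  tauto

theorem isOrthonormalFamily_finCons_iff (hB : ∀ x y, B y x = σ (B x y)) {m : ℕ} {x : V}
    {w : Fin m → V} : IsOrthonormalFamily B (Fin.cons x w : Fin (m + 1) → V) ↔
      B x x = 1 ∧ (∀ i, B x (w i) = 0) ∧ IsOrthonormalFamily B w := by
  have hflip : (∀ i, B (w i) x = 0) ↔ ∀ i, B x (w i) = 0 := by
    simp only [hB x, map_eq_zero]
  simp only [IsOrthonormalFamily, Fin.forall_fin_succ, Fin.cons_zero, Fin.cons_succ,
    Fin.succ_inj, Fin.succ_ne_zero, (Fin.succ_ne_zero _).symm, if_true, if_false, forall_and,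
    hflip]
  tauto

namespace IsOrthonormalFamily

variable {ι : Type*} [Fintype ι] [DecidableEq ι] {v : ι → V}

theorem apply_sum_left (hv : IsOrthonormalFamily B v) (c : ι → K) (b : ι) :
    B (∑ a, c a • v a) (v b) = c b := by
  simp [hv _ b]

theorem apply_sub_sum_left (hv : IsOrthonormalFamily B v) (y : V) (b : ι) :
    B (y - ∑ a, B y (v a) • v a) (v b) = 0 := by
  rw [map_sub, LinearMap.sub_apply, hv.apply_sum_left, sub_self]

theorem linearIndependent {ι : Type*} [Finite ι] [DecidableEq ι] {v : ι → V}
    (hv : IsOrthonormalFamily B v) : LinearIndependent K v := by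
  let := Fintype.ofFinite ι
  refine Fintype.linearIndependent_iff.2 fun c hc b => ?_
  rw [← hv.apply_sum_left c b, hc, map_zero, LinearMap.zero_apply]

theorem sum_apply_smul (hv : IsOrthonormalFamily B v) [FiniteDimensional K V]
    (hcard : Fintype.card ι = Module.finrank K V) (x : V) : ∑ a, B x (v a) • v a = x := by
  obtain ⟨c, rfl⟩ := (Submodule.mem_span_range_iff_exists_fun K).1
    (hv.linearIndependent.span_eq_top_of_card_eq_finrank' hcard ▸ Submodule.mem_top (x := x))
  simp only [hv.apply_sum_left]

end IsOrthonormalFamily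

theorem exists_apply_smul_smul_eq_one (hσ : IsConjugation q σ) (hB : ∀ x y, B y x = σ (B x y))
    {w : V} (hw : B w w ≠ 0) : ∃ a : K, B (a • w) (a • w) = 1 := by
  obtain ⟨a, ha⟩ := hσ.exists_mul_apply_eq (c := (B w w)⁻¹) (by rw [map_inv₀, ← hB])
    (inv_ne_zero hw)
  refine ⟨a, ?_⟩
  simp only [map_smul, LinearMap.smul_apply, smul_eq_mul, LinearMap.map_smulₛₗ]
  rw [← mul_assoc, mul_comm (σ a), ha, inv_mul_cancel₀ hw]

theorem apply_eq_zero_of_forall_apply_self_eq_zero (hσ : IsConjugation q σ)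
    (hB : ∀ x y, B y x = σ (B x y)) {W : Submodule K V} (hW : ∀ w ∈ W, B w w = 0) {x y : V}
    (hx : x ∈ W) (hy : y ∈ W) : B x y = 0 := by
  by_contra hne
  obtain ⟨c, hc⟩ := hσ.exists_mul_add_apply_ne_zero hne
  have hadd := hW (c • x + y) (W.add_mem (W.smul_mem c hx) hy)
  simp only [map_add, map_smul, LinearMap.add_apply, LinearMap.smul_apply, smul_eq_mul,
    LinearMap.map_smulₛₗ, hW x hx, hW y hy, hB x y] at hadd
  refine hc ?_
  rw [map_mul]
  linear_combination hadd

namespace IsOrthonormalFamily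

variable {ι : Type*} [Fintype ι] [DecidableEq ι] {v : ι → V}

/-- Otherwise the orthogonal complement of `v` is totally isotropic, so that it lies in the radical
of `B`. -/
theorem exists_unit (hσ : IsConjugation q σ) (hB : ∀ x y, B y x = σ (B x y))
    (hnd : B.SeparatingLeft) [FiniteDimensional K V] (hv : IsOrthonormalFamily B v)
    (hcard : Fintype.card ι < Module.finrank K V) :
    ∃ x, B x x = 1 ∧ ∀ a, B x (v a) = 0 := by
  by_contra! hno
  let W : Submodule K V := ⨅ a, LinearMap.ker (B.flip (v a))
  have hmem : ∀ {w}, w ∈ W ↔ ∀ a, B w (v a) = 0 := by simp [W]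
  have hiso : ∀ w ∈ W, B w w = 0 := fun w hw => by
    by_contra hww
    obtain ⟨c, hc⟩ := exists_apply_smul_smul_eq_one hσ hB hww
    obtain ⟨a, ha⟩ := hno _ hc
    exact ha (hmem.1 (W.smul_mem c hw) a)
  have hproj : ∀ y, y - ∑ a, B y (v a) • v a ∈ W := fun y => hmem.2 (hv.apply_sub_sum_left y)
  have hzero : ∀ y, y - ∑ a, B y (v a) • v a = 0 := fun y => by
    refine hnd _ fun z => ?_
    rw [← sub_add_cancel z (∑ a, B z (v a) • v a), map_add,
      apply_eq_zero_of_forall_apply_self_eq_zero hσ hB hiso (hproj y) (hproj z), zero_add, map_sum]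
    exact Finset.sum_eq_zero fun a _ => by
      rw [LinearMap.map_smulₛₗ, hv.apply_sub_sum_left, smul_zero]
  have hspan : Submodule.span K (Set.range v) = ⊤ := eq_top_iff.2 fun y _ =>
    (Submodule.mem_span_range_iff_exists_fun K).2 ⟨_, (sub_eq_zero.1 (hzero y)).symm⟩
  exact hcard.not_ge (finrank_le_of_span_eq_top hspan)

theorem exists_extension (hσ : IsConjugation q σ) (hB : ∀ x y, B y x = σ (B x y))
    (hnd : B.SeparatingLeft) [FiniteDimensional K V] (hv : IsOrthonormalFamily B v) (m : ℕ)
    (hcard : Fintype.card ι + m ≤ Module.finrank K V) :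
    ∃ w : Fin m → V, IsOrthonormalFamily B (Sum.elim v w) := by
  simp only [isOrthonormalFamily_sumElim_iff hB]
  induction m with
  | zero => exact ⟨Fin.elim0, hv, fun a => a.elim0, fun i => i.elim0⟩
  | succ m ih =>
    obtain ⟨w, hw⟩ := ih (by lia)
    obtain ⟨x, hx, hxvw⟩ :=
      exists_unit hσ hB hnd ((isOrthonormalFamily_sumElim_iff hB).2 hw) (by simp; lia)
    exact ⟨Fin.cons x w, hv,
      (isOrthonormalFamily_finCons_iff hB).2 ⟨hx, fun i => hxvw (.inr i), hw.2.1⟩,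
      Fin.cases (fun a => hxvw (.inl a)) hw.2.2⟩

theorem natCard_unit (hσ : IsConjugation q σ) (hB : ∀ x y, B y x = σ (B x y))
    (hnd : B.SeparatingLeft) [FiniteDimensional K V] (hv : IsOrthonormalFamily B v) {m : ℕ}
    (hcard : Fintype.card ι + m = Module.finrank K V) :
    Nat.card {x : V // B x x = 1 ∧ ∀ a, B x (v a) = 0} =
      Nat.card {c : Fin m → K // ∑ i, c i * σ (c i) = 1} := by
  obtain ⟨w, hvw⟩ := exists_extension hσ hB hnd hv m hcard.le
  have hw := ((isOrthonormalFamily_sumElim_iff hB).1 hvw).2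
  have hexp : ∀ x, (∀ a, B x (v a) = 0) → ∑ i, B x (w i) • w i = x := fun x hx => by
    conv_rhs => rw [← hvw.sum_apply_smul (by simpa using hcard) x]
    simp [hx]
  have hnorm : ∀ x (c : Fin m → K), B x (∑ i, c i • w i) = ∑ i, B x (w i) * σ (c i) :=
    fun x c => by simp only [map_sum, LinearMap.map_smulₛₗ, smul_eq_mul, mul_comm]
  refine Nat.card_congr
    { toFun := fun x => ⟨fun i => B x.1 (w i), ?_⟩
      invFun := fun c => ⟨∑ i, c.1 i • w i, ?_, fun a => by simp [hw.2]⟩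
      left_inv := fun x => Subtype.ext (hexp x.1 x.2.2)
      right_inv := fun c => Subtype.ext (funext (hw.1.apply_sum_left c.1)) }
  · rw [← hnorm, hexp x.1 x.2.2, x.2.1]
  · simpa only [hnorm, hw.1.apply_sum_left] using c.2

theorem natCard_succ (hσ : IsConjugation q σ) (hB : ∀ x y, B y x = σ (B x y))
    (hnd : B.SeparatingLeft) [FiniteDimensional K V] {j m : ℕ}
    (hcard : j + m = Module.finrank K V) :
    Nat.card {v : Fin (j + 1) → V // IsOrthonormalFamily B v} =
      Nat.card {v : Fin j → V // IsOrthonormalFamily B v} *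
        Nat.card {c : Fin m → K // ∑ i, c i * σ (c i) = 1} := by
  have := hσ.finite
  have : Finite V := Module.finite_of_finite K
  let := Fintype.ofFinite {v : Fin j → V // IsOrthonormalFamily B v}
  have htail : ∀ v : Fin (j + 1) → V, IsOrthonormalFamily B v ↔ B (v 0) (v 0) = 1 ∧
      (∀ i, B (v 0) (Fin.tail v i) = 0) ∧ IsOrthonormalFamily B (Fin.tail v) := fun v => by
    rw [← isOrthonormalFamily_finCons_iff hB, Fin.cons_self_tail]
  let e : {v : Fin (j + 1) → V // IsOrthonormalFamily B v} ≃
      Σ v : {v : Fin j → V // IsOrthonormalFamily B v},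
        {x : V // B x x = 1 ∧ ∀ a, B x (v.1 a) = 0} :=
    { toFun := fun v => have h := (htail v.1).1 v.2
        ⟨⟨Fin.tail v.1, h.2.2⟩, v.1 0, h.1, h.2.1⟩
      invFun := fun p => ⟨Fin.cons p.2.1 p.1.1,
        (isOrthonormalFamily_finCons_iff hB).2 ⟨p.2.2.1, p.2.2.2, p.1.2⟩⟩
      left_inv := fun v => Subtype.ext (Fin.cons_self_tail v.1)
      right_inv := fun p => rfl }
  have hfib : ∀ v : {v : Fin j → V // IsOrthonormalFamily B v},
      Nat.card {x : V // B x x = 1 ∧ ∀ a, B x (v.1 a) = 0} =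
        Nat.card {c : Fin m → K // ∑ i, c i * σ (c i) = 1} := fun v =>
    natCard_unit hσ hB hnd v.2 (by simpa using hcard)
  rw [Nat.card_congr e, Nat.card_sigma, Finset.sum_congr rfl fun v _ => hfib v, Finset.sum_const,
    Finset.card_univ, smul_eq_mul, Nat.card_eq_fintype_card (α := {v : Fin j → V // _})]

theorem natCard_mul_prod_eq_prod (hσ : IsConjugation q σ) (hB : ∀ x y, B y x = σ (B x y))
    (hnd : B.SeparatingLeft) [FiniteDimensional K V] {j m : ℕ}
    (hcard : j + m = Module.finrank K V) :
    (Nat.card {v : Fin j → V // IsOrthonormalFamily B v} : ℤ) *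
        ∏ i ∈ Finset.range m, (q ^ i * (q ^ (i + 1) - (-1) ^ (i + 1)) : ℤ) =
      ∏ i ∈ Finset.range (j + m), (q ^ i * (q ^ (i + 1) - (-1) ^ (i + 1)) : ℤ) := by
  induction j generalizing m with
  | zero =>
    have : Unique {v : Fin 0 → V // IsOrthonormalFamily B v} :=
      ⟨⟨⟨Fin.elim0, fun a => a.elim0⟩⟩, fun v => Subsingleton.elim _ _⟩
    rw [Nat.card_unique, Nat.cast_one, one_mul, zero_add]
  | succ j ih =>
    have hcard' : j + (m + 1) = Module.finrank K V := by lia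
    rw [add_assoc, add_comm 1, ← ih hcard', natCard_succ hσ hB hnd hcard', Nat.cast_mul,
      hσ.natCard_sum_mul_apply_eq_one, Finset.prod_range_succ]
    ring

theorem natCard_eq_prod (hσ : IsConjugation q σ) (hB : ∀ x y, B y x = σ (B x y))
    (hnd : B.SeparatingLeft) [FiniteDimensional K V] {n : ℕ} (hn : Module.finrank K V = n) :
    (Nat.card {v : Fin n → V // IsOrthonormalFamily B v} : ℤ) =
      ∏ i ∈ Finset.range n, (q ^ i * (q ^ (i + 1) - (-1) ^ (i + 1)) : ℤ) := by
  simpa using natCard_mul_prod_eq_prod hσ hB hnd (j := n) (m := 0) hn.symm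

end IsOrthonormalFamily

end OrthonormalFamilies

section HermitianMatrices

variable {K ι κ : Type*} [Field K] [Fintype ι] {q : ℕ} {σ : K →+* K}

/-! ### Hermitian matrices -/

/-- The sesquilinear form `x, y ↦ xᵀ β σ(y)` of a matrix `β`; it is linear in the first variable
and `σ`-linear in the second one. -/
def hermitianForm (σ : K →+* K) (β : Matrix ι ι K) : (ι → K) →ₗ[K] (ι → K) →ₛₗ[σ] K :=
  LinearMap.mk₂'ₛₗ (RingHom.id K) σ (fun x y => x ⬝ᵥ β *ᵥ (σ ∘ y))
    (fun x y z => add_dotProduct x y _) (fun c x y => smul_dotProduct c x _)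
    (fun x y z => by
      rw [← dotProduct_add, ← Matrix.mulVec_add]
      congr 2
      ext i
      simp)
    (fun c x y => by
      rw [← dotProduct_smul, ← Matrix.mulVec_smul]
      congr 2
      ext i
      simp)

theorem hermitianForm_apply (β : Matrix ι ι K) (x y : ι → K) :
    hermitianForm σ β x y = x ⬝ᵥ β *ᵥ (σ ∘ y) :=
  rfl

theorem hermitianForm_symm (hσ : IsConjugation q σ) {β : Matrix ι ι K} (hβ : βᵀ = β.map σ)
    (x y : ι → K) : hermitianForm σ β y x = σ (hermitianForm σ β x y) := by
  have hmap : σ ∘ (β *ᵥ (σ ∘ y)) = βᵀ *ᵥ y := by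
    have hσσ : σ ∘ σ ∘ y = y := funext fun i => hσ.apply_apply _
    rw [hβ]
    conv_rhs => rw [← hσσ]
    exact funext (RingHom.map_mulVec σ β _)
  rw [hermitianForm_apply, hermitianForm_apply, RingHom.map_dotProduct, hmap,
    Matrix.mulVec_transpose, Matrix.dotProduct_mulVec, dotProduct_comm]

theorem separatingLeft_hermitianForm [DecidableEq ι] {β : Matrix ι ι K} (hdet : β.det ≠ 0) :
    (hermitianForm σ β).SeparatingLeft := fun x hx => by
  refine Matrix.eq_zero_of_vecMul_eq_zero hdet (funext fun i => ?_)
  have hsingle : σ ∘ Pi.single i 1 = Pi.single i (1 : K) := by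
    funext j
    simp [Pi.single_apply, apply_ite σ]
  rw [Pi.zero_apply, ← hx (Pi.single i 1), hermitianForm_apply, hsingle, Matrix.mulVec_single_one]
  rfl

/-- The pullback `Aᵀ β σ(A)` along `A` of the sesquilinear form of `β`. It is the Gram matrix of
the columns of `A`, and `A` belongs to the unitary group of `β` if it equals `β`. -/
def hermitianCongr (σ : K →+* K) (β : Matrix ι ι K) (A : Matrix ι κ K) : Matrix κ κ K :=
  Aᵀ * β * A.map σ

theorem hermitianCongr_apply (β : Matrix ι ι K) (A : Matrix ι κ K) (i j : κ) :
    hermitianCongr σ β A i j = hermitianForm σ β (Aᵀ i) (Aᵀ j) := by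
  rw [hermitianForm_apply, Matrix.dotProduct_mulVec]
  rfl

theorem isOrthonormalFamily_hermitianForm_iff [DecidableEq κ] {β : Matrix ι ι K} {v : κ → ι → K} :
    IsOrthonormalFamily (hermitianForm σ β) v ↔ hermitianCongr σ β (Matrix.of v)ᵀ = 1 := by
  simp only [← Matrix.ext_iff, hermitianCongr_apply, Matrix.one_apply]
  rfl

theorem hermitianCongr_mul [Fintype κ] {μ : Type*} (β : Matrix ι ι K) (A : Matrix ι κ K)
    (C : Matrix κ μ K) :
    hermitianCongr σ β (A * C) = hermitianCongr σ (hermitianCongr σ β A) C := by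
  simp only [hermitianCongr, Matrix.transpose_mul, Matrix.map_mul, Matrix.mul_assoc]

theorem hermitianCongr_submatrix [Fintype κ] (β : Matrix ι ι K) (A : Matrix ι ι K) (e : κ ≃ ι) :
    hermitianCongr σ (β.submatrix e e) (A.submatrix e e) =
      (hermitianCongr σ β A).submatrix e e := by
  simp only [hermitianCongr, Matrix.transpose_submatrix, ← Matrix.submatrix_map,
    Matrix.submatrix_mul_equiv]

variable [DecidableEq ι]

theorem hermitianCongr_one (β : Matrix ι ι K) : hermitianCongr σ β 1 = β := by
  simp [hermitianCongr]

theorem hermitianCongr_injective (P : GL ι K) :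
    Function.Injective fun β : Matrix ι ι K => hermitianCongr σ β P.1 := fun β β' h => by
  rw [← hermitianCongr_one (σ := σ) β, ← hermitianCongr_one (σ := σ) β', ← P.mul_inv,
    hermitianCongr_mul, hermitianCongr_mul]
  exact congrArg (hermitianCongr σ · _) h

theorem mem_hermitianUnitaryGroup_iff {n : ℕ} {β : Matrix (Fin n) (Fin n) K} {M : GL (Fin n) K} :
    M ∈ hermitianUnitaryGroup σ β ↔ hermitianCongr σ β M.1 = β :=
  Iff.rfl

theorem det_ne_zero_of_hermitianCongr_eq_one {β A : Matrix ι ι K}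
    (h : hermitianCongr σ β A = 1) : A.det ≠ 0 := fun hA => by
  simpa [hermitianCongr, hA] using congrArg Matrix.det h

theorem exists_hermitianCongr_eq_one (hσ : IsConjugation q σ) {β : Matrix ι ι K}
    (hβ : βᵀ = β.map σ) (hdet : β.det ≠ 0) : ∃ P : GL ι K, hermitianCongr σ β P.1 = 1 := by
  have hempty : IsOrthonormalFamily (hermitianForm σ β) (Fin.elim0 : Fin 0 → ι → K) :=
    fun a => a.elim0
  obtain ⟨w, hw⟩ := hempty.exists_extension hσ (hermitianForm_symm hσ hβ)
    (separatingLeft_hermitianForm hdet) (Fintype.card ι) (by simp)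
  have hwe : IsOrthonormalFamily (hermitianForm σ β) (w ∘ Fintype.equivFin ι) := fun a b => by
    simpa using hw (.inr (Fintype.equivFin ι a)) (.inr (Fintype.equivFin ι b))
  have hP := isOrthonormalFamily_hermitianForm_iff.1 hwe
  exact ⟨Matrix.GeneralLinearGroup.mkOfDetNeZero _ (det_ne_zero_of_hermitianCongr_eq_one hP), hP⟩

theorem natCard_hermitianCongr_eq_one {β : Matrix ι ι K} :
    Nat.card {A : GL ι K // hermitianCongr σ β A.1 = 1} =
      Nat.card {v : ι → ι → K // IsOrthonormalFamily (hermitianForm σ β) v} :=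
  Nat.card_congr
    { toFun := fun A => ⟨A.1.1ᵀ, isOrthonormalFamily_hermitianForm_iff.2 A.2⟩
      invFun := fun v => have h := isOrthonormalFamily_hermitianForm_iff.1 v.2
        ⟨Matrix.GeneralLinearGroup.mkOfDetNeZero _ (det_ne_zero_of_hermitianCongr_eq_one h), h⟩
      left_inv := fun _ => Subtype.ext (Units.ext rfl)
      right_inv := fun _ => rfl }

theorem natCard_hermitianUnitaryGroup (hσ : IsConjugation q σ) {n : ℕ}
    {β : Matrix (Fin n) (Fin n) K} (hβ : βᵀ = β.map σ) (hdet : β.det ≠ 0) :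
    (Nat.card (hermitianUnitaryGroup σ β) : ℤ) =
      ∏ i ∈ Finset.range n, (q ^ i * (q ^ (i + 1) - (-1) ^ (i + 1)) : ℤ) := by
  obtain ⟨P, hP⟩ := exists_hermitianCongr_eq_one hσ hβ hdet
  have hmul : ∀ M : GL (Fin n) K, M ∈ hermitianUnitaryGroup σ β ↔
      hermitianCongr σ β (Equiv.mulRight P M).1 = 1 := fun M => by
    rw [mem_hermitianUnitaryGroup_iff, ← (hermitianCongr_injective (σ := σ) P).eq_iff]
    simp only [Equiv.coe_mulRight, Units.val_mul, hermitianCongr_mul, hP]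
  rw [Nat.card_congr ((Equiv.mulRight P).subtypeEquiv
      (q := fun A => hermitianCongr σ β A.1 = 1) hmul), natCard_hermitianCongr_eq_one,
    IsOrthonormalFamily.natCard_eq_prod hσ (hermitianForm_symm hσ hβ)
      (separatingLeft_hermitianForm hdet) (by simp)]

theorem exists_hermitianCongr_eq (hσ : IsConjugation q σ) {β β' : Matrix ι ι K}
    (hβ : βᵀ = β.map σ) (hdet : β.det ≠ 0) (hβ' : β'ᵀ = β'.map σ) (hdet' : β'.det ≠ 0) :
    ∃ Q : GL ι K, hermitianCongr σ β Q.1 = β' := by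
  obtain ⟨P, hP⟩ := exists_hermitianCongr_eq_one hσ hβ hdet
  obtain ⟨P', hP'⟩ := exists_hermitianCongr_eq_one hσ hβ' hdet'
  refine ⟨P * P'⁻¹, ?_⟩
  rw [Units.val_mul, hermitianCongr_mul, hP, ← hP', ← hermitianCongr_mul, P'.mul_inv,
    hermitianCongr_one]

theorem exists_injective_hermitianUnitaryGroup_of_hermitianCongr_eq {G : Type*} [Group G] {n : ℕ}
    {β η : Matrix (Fin n) (Fin n) K} {D : G →* Matrix (Fin n) (Fin n) K}
    (hD : Function.Injective D) (hDη : ∀ g, hermitianCongr σ η (D g) = η) {Q : GL (Fin n) K}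
    (hQ : hermitianCongr σ η Q.1 = β) :
    ∃ φ : G →* hermitianUnitaryGroup σ β, Function.Injective φ := by
  let φ : G →* GL (Fin n) K := (MulAut.conj Q⁻¹).toMonoidHom.comp D.toHomUnits
  have hconj : ∀ g, Q.1 * (φ g).1 = D g * Q.1 := fun g => by
    change (Q * (Q⁻¹ * D.toHomUnits g * Q⁻¹⁻¹)).1 = (D.toHomUnits g * Q).1
    rw [inv_inv, mul_assoc, mul_inv_cancel_left]
  have hφ : ∀ g, φ g ∈ hermitianUnitaryGroup σ β := fun g => by
    rw [mem_hermitianUnitaryGroup_iff, ← hQ, ← hermitianCongr_mul, hconj, hermitianCongr_mul, hDη]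
  refine ⟨φ.codRestrict _ hφ, (MonoidHom.injective_codRestrict _ _ _).2 ?_⟩
  exact (MulAut.conj Q⁻¹).injective.comp fun g h hgh => hD (congrArg Units.val hgh)

end HermitianMatrices

section LeviSubgroup

/-! ### The general linear group inside a unitary group -/

variable {K κ κ' : Type*} [Field K] [DecidableEq κ] [DecidableEq κ'] {q : ℕ} {σ : K →+* K}

/-- The Hermitian matrix of the orthogonal sum of a hyperbolic form, whose two Lagrangians have
bases indexed by `κ`, and the standard form in the variables `κ'`. It is a Hermitian matrix of which
the general linear group visibly acts by isometries. -/
def hyperbolicMatrix (K κ κ' : Type*) [Field K] [DecidableEq κ] [DecidableEq κ'] :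
    Matrix ((κ ⊕ κ) ⊕ κ') ((κ ⊕ κ) ⊕ κ') K :=
  Matrix.fromBlocks (Matrix.fromBlocks 0 1 1 0) 0 0 1

theorem transpose_hyperbolicMatrix (σ : K →+* K) :
    (hyperbolicMatrix K κ κ')ᵀ = (hyperbolicMatrix K κ κ').map σ := by
  simp [hyperbolicMatrix, Matrix.fromBlocks_transpose, Matrix.fromBlocks_map]

variable [Fintype κ] [Fintype κ']

theorem det_hyperbolicMatrix_ne_zero : (hyperbolicMatrix K κ κ').det ≠ 0 := by
  have hsq : hyperbolicMatrix K κ κ' * hyperbolicMatrix K κ κ' = 1 := by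
    simp [hyperbolicMatrix, Matrix.fromBlocks_multiply]
  exact (Matrix.isUnit_det_of_left_inverse hsq).ne_zero

/-- The Levi subgroup of the stabilizer of a Lagrangian: the action of `GL κ K` on a Lagrangian of
`hyperbolicMatrix K κ κ'`, extended to an isometry by the conjugate dual action on the other
Lagrangian and the trivial action on the variables `κ'`. -/
def leviHom (σ : K →+* K) (κ κ' : Type*) [Fintype κ] [DecidableEq κ] [Fintype κ'] [DecidableEq κ'] :
    GL κ K →* Matrix ((κ ⊕ κ) ⊕ κ') ((κ ⊕ κ) ⊕ κ') K where
  toFun A := Matrix.fromBlocks (Matrix.fromBlocks A.1 0 0 (A⁻¹.1ᵀ.map σ)) 0 0 1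
  map_one' := by simp [-Matrix.coe_units_inv]
  map_mul' A B := by
    simp [-Matrix.coe_units_inv, Matrix.fromBlocks_multiply, Matrix.transpose_mul, Matrix.map_mul]

theorem hermitianCongr_leviHom (hσ : IsConjugation q σ) (A : GL κ K) :
    hermitianCongr σ (hyperbolicMatrix K κ κ') (leviHom σ κ κ' A) = hyperbolicMatrix K κ κ' := by
  have hmul : A.1ᵀ * A⁻¹.1ᵀ = 1 := by rw [← Matrix.transpose_mul, A.inv_mul, Matrix.transpose_one]
  have hmulσ : A⁻¹.1.map σ * A.1.map σ = 1 := by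
    rw [← Matrix.map_mul, A.inv_mul, Matrix.map_one _ (map_zero σ) (map_one σ)]
  have hmap : (A⁻¹.1.map σ).map σ = A⁻¹.1 := Matrix.ext fun i j => hσ.apply_apply _
  simp only [hermitianCongr, leviHom, hyperbolicMatrix, MonoidHom.coe_mk, OneHom.coe_mk,
    Matrix.fromBlocks_transpose, Matrix.fromBlocks_map, Matrix.fromBlocks_multiply, hmap,
    Matrix.transpose_map, Matrix.transpose_transpose]
  simp [-Matrix.coe_units_inv, Matrix.fromBlocks_multiply, hmul, hmulσ]

theorem leviHom_injective (σ : K →+* K) : Function.Injective (leviHom σ κ κ') := fun A B h =>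
  Units.ext (by simpa [leviHom] using congrArg (fun M => M.toBlocks₁₁.toBlocks₁₁) h)

theorem exists_injective_hermitianUnitaryGroup (hσ : IsConjugation q σ) {m n : ℕ}
    (hmn : 2 * m ≤ n) {β : Matrix (Fin n) (Fin n) K} (hβ : βᵀ = β.map σ) (hdet : β.det ≠ 0) :
    ∃ φ : GL (Fin m) K →* hermitianUnitaryGroup σ β, Function.Injective φ := by
  let e : (Fin m ⊕ Fin m) ⊕ Fin (n - 2 * m) ≃ Fin n := Fintype.equivFinOfCardEq (by simp; lia)
  let η := (hyperbolicMatrix K (Fin m) (Fin (n - 2 * m))).submatrix e.symm e.symm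
  have hη : ηᵀ = η.map σ := by
    rw [Matrix.transpose_submatrix, transpose_hyperbolicMatrix σ, Matrix.submatrix_map]
  have hηdet : η.det ≠ 0 := by
    rw [Matrix.det_submatrix_equiv_self]
    exact det_hyperbolicMatrix_ne_zero
  obtain ⟨Q, hQ⟩ := exists_hermitianCongr_eq hσ hη hηdet hβ hdet
  let D : GL (Fin m) K →* Matrix (Fin n) (Fin n) K :=
    (Matrix.reindexAlgEquiv K K e).toMulEquiv.toMonoidHom.comp
      (leviHom σ (Fin m) (Fin (n - 2 * m)))
  have hD : ∀ A, hermitianCongr σ η (D A) = η := fun A =>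
    (hermitianCongr_submatrix _ _ e.symm).trans
      (congrArg (fun M => M.submatrix e.symm e.symm) (hermitianCongr_leviHom hσ A))
  exact exists_injective_hermitianUnitaryGroup_of_hermitianCongr_eq
    ((Matrix.reindexAlgEquiv K K e).injective.comp (leviHom_injective σ)) hD hQ (D := D)

end LeviSubgroup

section Orders

/-! ### Orders and indices -/

theorem natCard_generalLinearGroup {K : Type*} [Field K] {q : ℕ} (hK : Nat.card K = q ^ 2)
    (hq : 0 < q) (n : ℕ) : (Nat.card (GL (Fin n) K) : ℤ) =
      ∏ i ∈ Finset.range n, (q ^ (2 * i) * (q ^ (2 * (i + 1)) - 1) : ℤ) := by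
  have : Finite K := Nat.finite_of_card_ne_zero (hK ▸ pow_ne_zero 2 hq.ne')
  have := Fintype.ofFinite K
  rw [Matrix.card_GL_field, ← Nat.card_eq_fintype_card, hK, Nat.cast_prod,
    Finset.prod_mul_distrib, ← Finset.prod_range_reflect fun i => ((q : ℤ) ^ (2 * (i + 1)) - 1),
    ← Finset.prod_mul_distrib, Finset.prod_range]
  refine Finset.prod_congr rfl fun i _ => ?_
  have hexp : 2 * n = 2 * i + 2 * (n - 1 - i + 1) := by have := i.2; lia
  rw [← pow_mul, ← pow_mul, Nat.cast_sub (Nat.pow_le_pow_right hq (by lia)), hexp]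
  push_cast
  ring

theorem not_dvd_index_of_natCard_eq_mul {G H : Type*} [Group G] [Finite G] [Group H] {φ : H →* G}
    (hφ : Function.Injective φ) {l : ℕ} {c : ℤ} (hc : (Nat.card G : ℤ) = Nat.card H * c)
    (hl : (c : ZMod l) ≠ 0) : ¬ l ∣ φ.range.index := by
  have := Finite.of_injective φ hφ
  have hindex : (Nat.card H : ℤ) * φ.range.index = Nat.card H * c := by
    rw [← hc, ← φ.range.card_mul_index, Nat.cast_mul,
      Nat.card_congr (MonoidHom.ofInjective hφ).toEquiv]
  rw [← mul_left_cancel₀ (Nat.cast_ne_zero.2 Nat.card_pos.ne') hindex, Int.cast_natCast] at hl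
  rwa [← ZMod.natCast_eq_zero_iff]

theorem orderOf_natCast_eq {q l d : ℕ} (hq : 0 < q)
    (hd : IsLeast {m : ℕ | 0 < m ∧ l ∣ q ^ m - 1} d) : orderOf (q : ZMod l) = d := by
  have hdvd : ∀ m, l ∣ q ^ m - 1 ↔ (q : ZMod l) ^ m = 1 := fun m => by
    rw [← ZMod.natCast_eq_zero_iff, Nat.cast_sub (Nat.one_le_pow _ _ hq), sub_eq_zero,
      Nat.cast_pow, Nat.cast_one]
  refine (orderOf_eq_iff hd.1.1).2 ⟨(hdvd d).1 hd.1.2, fun m hm hm0 hpow => ?_⟩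
  exact hm.not_ge (hd.2 ⟨hm0, (hdvd m).2 hpow⟩)

section Ring

variable {R : Type*} [Ring R] {x : R} {i : ℕ}

theorem orderOf_eq_two_mul_gcd (hR : (-1 : R) ≠ 1) (hx : x ^ i = -1) :
    orderOf x = 2 * (orderOf x).gcd i := by
  have hi : i ≠ 0 := fun hi => hR (by rw [← hx, hi, pow_zero])
  have htwo : orderOf (x ^ i) = 2 := orderOf_eq_prime (by rw [hx, neg_one_sq]) (by rwa [hx])
  rw [orderOf_pow' x hi] at htwo
  rw [← htwo, Nat.div_mul_cancel (Nat.gcd_dvd_left _ _)]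

theorem pow_ne_neg_one_of_odd (hR : (-1 : R) ≠ 1) (hx : orderOf x % 4 ≠ 2) (hi : Odd i) :
    x ^ i ≠ -1 := fun hxi => by
  have horder := orderOf_eq_two_mul_gcd hR hxi
  have hodd := Nat.odd_iff.1 (hi.of_dvd_nat (Nat.gcd_dvd_right (orderOf x) i))
  lia

theorem pow_ne_neg_neg_one_pow (hR : (-1 : R) ≠ 1) (hx : orderOf x % 4 = 2) (i : ℕ) :
    x ^ i ≠ -(-1) ^ i := fun hxi => by
  have htwo : 2 ∣ orderOf x := by lia
  rcases i.even_or_odd with hi | hi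
  · rw [hi.neg_one_pow] at hxi
    have horder := orderOf_eq_two_mul_gcd hR hxi
    have hgcd := Nat.dvd_gcd htwo hi.two_dvd
    lia
  · rw [hi.neg_one_pow, neg_neg] at hxi
    have heven := even_iff_two_dvd.2 (htwo.trans (orderOf_dvd_of_pow_eq_one hxi))
    exact Nat.not_even_iff_odd.2 hi heven

end Ring

theorem prod_range_pow_mul_pow_sub_neg_one_pow {R : Type*} [CommRing R] (q : R) (n : ℕ) :
    ∏ i ∈ Finset.range n, q ^ i * (q ^ (i + 1) - (-1) ^ (i + 1)) =
      (∏ i ∈ Finset.range (n / 2), q ^ (2 * i) * (q ^ (2 * (i + 1)) - 1)) *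
        (q ^ (n / 2) * ∏ i ∈ Finset.range ((n + 1) / 2), q ^ (2 * i) * (q ^ (2 * i + 1) + 1)) := by
  induction n with
  | zero => simp
  | succ n ih =>
    rw [Finset.prod_range_succ, ih]
    obtain ⟨m, rfl | rfl⟩ := n.even_or_odd'
    · rw [show (2 * m + 1 + 1) / 2 = m + 1 by lia, show (2 * m + 1) / 2 = m by lia,
        show 2 * m / 2 = m by lia, Finset.prod_range_succ _ m, (odd_two_mul_add_one m).neg_one_pow]
      ring
    · have heven : Even (2 * m + 1 + 1) := (odd_two_mul_add_one m).add_one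
      rw [show (2 * m + 1 + 1 + 1) / 2 = m + 1 by lia, show (2 * m + 1 + 1) / 2 = m + 1 by lia,
        show (2 * m + 1) / 2 = m by lia, Finset.prod_range_succ _ m, Finset.prod_range_succ _ m,
        heven.neg_one_pow]
      ring

end Orders

section UnitaryGroups

/-! ### Essential dimension of unitary groups -/

section Cardinality

variable {K : Type*} [Field K] {q n : ℕ} {σ : K →+* K} {β : Matrix (Fin n) (Fin n) K}

theorem natCard_generalLinearGroup_eq_natCard_hermitianUnitaryGroup_mul (hσ : IsConjugation q σ)
    (hβ : βᵀ = β.map σ) (hdet : β.det ≠ 0) :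
    (Nat.card (GL (Fin n) K) : ℤ) = Nat.card (hermitianUnitaryGroup σ β) *
      ∏ i ∈ Finset.range n, (q ^ i * (q ^ (i + 1) + (-1) ^ (i + 1)) : ℤ) := by
  rw [natCard_hermitianUnitaryGroup hσ hβ hdet,
    natCard_generalLinearGroup hσ.card_eq hσ.one_lt.le, ← Finset.prod_mul_distrib]
  refine Finset.prod_congr rfl fun i _ => ?_
  have hsign : ((-1 : ℤ) ^ (i + 1)) ^ 2 = 1 := by rw [pow_right_comm, neg_one_sq, one_pow]
  linear_combination (q ^ i * q ^ i : ℤ) * hsign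

theorem natCard_hermitianUnitaryGroup_eq_natCard_generalLinearGroup_mul (hσ : IsConjugation q σ)
    (hβ : βᵀ = β.map σ) (hdet : β.det ≠ 0) :
    (Nat.card (hermitianUnitaryGroup σ β) : ℤ) = Nat.card (GL (Fin (n / 2)) K) *
      ((q : ℤ) ^ (n / 2) *
        ∏ i ∈ Finset.range ((n + 1) / 2), (q ^ (2 * i) * (q ^ (2 * i + 1) + 1) : ℤ)) := by
  rw [natCard_hermitianUnitaryGroup hσ hβ hdet, prod_range_pow_mul_pow_sub_neg_one_pow,
    natCard_generalLinearGroup hσ.card_eq hσ.one_lt.le]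

end Cardinality

variable {K : Type} [Field K] {q n l : ℕ} [Fact l.Prime] [Fact (2 < l)] {σ : K →+* K}
  {β : Matrix (Fin n) (Fin n) K} (k : Type u) [Field k]

theorem essDim_hermitianUnitaryGroup_eq_of_orderOf_mod_four_eq (hσ : IsConjugation q σ)
    (hβ : βᵀ = β.map σ) (hdet : β.det ≠ 0) (hq : (q : ZMod l) ≠ 0)
    (hq4 : orderOf (q : ZMod l) % 4 = 2) :
    essDim k (hermitianUnitaryGroup σ β) l = essDim k (GL (Fin n) K) l := by
  have := hσ.finite
  have hinj := (hermitianUnitaryGroup σ β).subtype_injective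
  refine essDim_eq_of_not_dvd_index k hinj Fact.out (not_dvd_index_of_natCard_eq_mul hinj
    (natCard_generalLinearGroup_eq_natCard_hermitianUnitaryGroup_mul hσ hβ hdet) ?_)
  push_cast
  refine Finset.prod_ne_zero_iff.2 fun i _ => mul_ne_zero (pow_ne_zero _ hq) fun h => ?_
  exact pow_ne_neg_neg_one_pow ZMod.neg_one_ne_one hq4 (i + 1) (eq_neg_of_add_eq_zero_left h)

theorem essDim_hermitianUnitaryGroup_eq_of_orderOf_mod_four_ne (hσ : IsConjugation q σ)
    (hβ : βᵀ = β.map σ) (hdet : β.det ≠ 0) (hq : (q : ZMod l) ≠ 0)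
    (hq4 : orderOf (q : ZMod l) % 4 ≠ 2) :
    essDim k (hermitianUnitaryGroup σ β) l = essDim k (GL (Fin (n / 2)) K) l := by
  have := hσ.finite
  obtain ⟨φ, hφ⟩ := exists_injective_hermitianUnitaryGroup hσ (Nat.mul_div_le n 2) hβ hdet
  refine (essDim_eq_of_not_dvd_index k hφ Fact.out (not_dvd_index_of_natCard_eq_mul hφ
    (natCard_hermitianUnitaryGroup_eq_natCard_generalLinearGroup_mul hσ hβ hdet) ?_)).symm
  push_cast
  refine mul_ne_zero (pow_ne_zero _ hq) (Finset.prod_ne_zero_iff.2 fun i _ =>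
    mul_ne_zero (pow_ne_zero _ hq) fun h => ?_)
  exact pow_ne_neg_one_of_odd ZMod.neg_one_ne_one hq4 (odd_two_mul_add_one i)
    (eq_neg_of_add_eq_zero_left h)

end UnitaryGroups

theorem theorem9_general {K : Type} [Field K] {q : ℕ} {σ : K →+* K} (hσ : IsConjugation q σ)
    {n l d : ℕ} (hl : l.Prime) (hl2 : l ≠ 2) (k : Type*) [Field k]
    (hd : IsLeast {m : ℕ | 0 < m ∧ l ∣ q ^ m - 1} d) {β : Matrix (Fin n) (Fin n) K}
    (hβ : βᵀ = β.map σ) (hβdet : β.det ≠ 0) :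
    (d % 4 = 2 → essDim k (hermitianUnitaryGroup σ β) l = essDim k (GL (Fin n) K) l) ∧
    (d % 4 ≠ 2 →
      essDim k (hermitianUnitaryGroup σ β) l = essDim k (GL (Fin (n / 2)) K) l) := by
  have : Fact l.Prime := ⟨hl⟩
  have : Fact (2 < l) := ⟨hl.two_le.lt_of_ne' hl2⟩
  obtain rfl := orderOf_natCast_eq hσ.one_lt.le hd
  have hq : (q : ZMod l) ≠ 0 := ((orderOf_pos_iff.1 hd.1.1).isUnit).ne_zero
  exact ⟨essDim_hermitianUnitaryGroup_eq_of_orderOf_mod_four_eq k hσ hβ hβdet hq,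
    essDim_hermitianUnitaryGroup_eq_of_orderOf_mod_four_ne k hσ hβ hβdet hq⟩

theorem theorem9 (p r n l d : ℕ) [Fact p.Prime] (hr : 0 < r) (hl : l.Prime)
    (hl2 : l ≠ 2) (hlp : l ≠ p)
    (k : Type*) [Field k] (hk : ringChar k ≠ l)
    (hd : IsLeast {m : ℕ | 0 < m ∧ l ∣ (p ^ r) ^ m - 1} d)
    (β : Matrix (Fin n) (Fin n) (GaloisField p (2 * r)))
    (hβ : βᵀ = β.map (conjFq p r)) (hβdet : β.det ≠ 0) :
    (d % 4 = 2 →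
      essDim k (UnitaryFq p r n β) l = essDim k (GL (Fin n) (GaloisField p (2 * r))) l) ∧
    (d % 4 ≠ 2 →
      essDim k (UnitaryFq p r n β) l =
        essDim k (GL (Fin (n / 2)) (GaloisField p (2 * r))) l) :=
  theorem9_general (isConjugation_conjFq p r hr) hl hl2 k hd hβ hβdet
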